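/- **Proposition (A priori frequency sparseness).** Let $d \ge 3$. Fix a Littlewood–Paley function $\varphi$ on $\mathbb{R}^d$: smooth, radial, with values in $[0,1]$, supported in $\{3/4 \le |\xi| \le 8/3\}$, with $\sum_{j\in\mathbb{Z}} \varphi(2^{-j}\xi) = 1$ for $\xi \neq 0$. Let $\dot\Delta_j = \varphi(2^{-j}D)$ and, for $J \in \mathbb{R}$, $\Delta_{<J} = \sum_{j\in\mathbb{Z},\, j<J} \dot\Delta_j$. There is a constant $C>0$, depending only on $d$ and $\varphi$, such that the following holds. Let $d < p \le \infty$ and $0<T\le\infty$, let $u_0 \in L^2_\sigma \cap L^p_\sigma(\mathbb{R}^d)$ (divergence-free vector fields), and let $u$ be a strong Navier–Stokes solution on $\mathbb{R}^d\times(0,T)$ with initial data $u_0$, that is, $u \in C((0,T);L^p)$ is bounded in $L^p$ on $(0,T']$ for every finite $T' \in (0,T)$, and for all $t\in(0,T)$ $$u(t) = e^{t\Delta}u_0 - \int_0^t e^{(t-s)\Delta}\,\mathbb{P}\,\nabla\cdot(u\otimes u)(s)\,ds ,$$ where $\mathbb{P}$ is the Leray projection. Then, for every $t \in (0,T)$,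 $u(\cdot,t) \in L^2$; and, with $$\ell_0(t) = \left( \frac{\|u(\cdot,t)\|_{L^2}}{\|u(\cdot,t)\|_{L^p}} \right)^{\mu_p}, \qquad \frac{1}{\mu_p} = d\left(\frac12 - \frac1p\right)$$ (and $\ell_0(t) = 0$ if $u(\cdot,t)=0$), for every $\beta \in (0,1)$ and every $J \in \mathbb{R}$ with $$2^{-J} \ge C\,\ell_0(t)\,\beta^{-\mu_p},$$ in particular when $2^{-J} = C\,\ell_0(t)\,\beta^{-\mu_p}$, the field $u(\cdot,t)$ is $(\beta,J)$-sparse in frequency in $L^p$: the series defining $\Delta_{<J}u(\cdot,t)$ converges almost everywhere and $$\|\Delta_{<J}u(\cdot,t)\|_{L^p} \le \beta\,\|u(\cdot,t)\|_{L^p}.$$ -/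

import Mathlib

open MeasureTheory Filter Topology
open scoped ENNReal NNReal ContDiff FourierTransform

noncomputable section

/-- `ℝ^d` with its Euclidean norm; vector fields are maps `Vec d → Vec d`. -/
abbrev Vec (d : ℕ) : Type := EuclideanSpace ℝ (Fin d)

/-- Divergence-free in the sense of distributions. -/
def IsDivFree {d : ℕ} (f : Vec d → Vec d) : Prop :=
  ∀ ψ : Vec d → ℝ, ContDiff ℝ ∞ ψ → HasCompactSupport ψ → ∫ x, fderiv ℝ ψ x (f x) = 0

/-- The space `L^p_σ(ℝ^d)` of divergence-free vector fields in `L^p`. -/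
def MemLpSigma {d : ℕ} (f : Vec d → Vec d) (p : ℝ≥0∞) : Prop :=
  MemLp f p volume ∧ IsDivFree f

/-- The partial derivative `∂_i f`. -/
def partialD {d : ℕ} (i : Fin d) (f : Vec d → ℝ) (x : Vec d) : ℝ :=
  fderiv ℝ f x (EuclideanSpace.single i 1)

/-- The heat kernel `(4πt)^{-d/2} exp(-|x|²/(4t))`. -/
def heatKernel {d : ℕ} (t : ℝ) (x : Vec d) : ℝ :=
  (4 * Real.pi * t) ^ (-(d : ℝ) / 2) * Real.exp (-‖x‖ ^ 2 / (4 * t))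

/-- The heat semigroup `e^{tΔ} f`, for `t > 0`. -/
def heatFlow {d : ℕ} (t : ℝ) (f : Vec d → Vec d) (x : Vec d) : Vec d :=
  ∫ y, heatKernel t (x - y) • f y

/-- The kernel of `e^{tΔ} ℙ ∇·`, where `ℙ` is the Leray projection, with symbol
`δ_ij - ξ_i ξ_j / |ξ|²`. Since `e^{-t|ξ|²} / |ξ|² = ∫_t^∞ e^{-s|ξ|²} ds`, the kernel of `e^{tΔ} ℙ`
is `δ_ij G_t + ∫_t^∞ ∂_i ∂_j G_s ds` with `G` the heat kernel; the divergence adds a `∂_k`. -/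
def oseenKernel {d : ℕ} (i j k : Fin d) (t : ℝ) (x : Vec d) : ℝ :=
  (if i = j then partialD k (heatKernel t) x else 0) +
    ∫ s in Set.Ioi t, partialD i (partialD j (partialD k (heatKernel s))) x

/-- `e^{tΔ} ℙ ∇·F` for a matrix field `F`, where `(∇·F)_j = ∑_k ∂_k F_jk`. -/
def oseenFlow {d : ℕ} (t : ℝ) (F : Vec d → Fin d → Fin d → ℝ) (x : Vec d) : Vec d :=
  WithLp.toLp 2 fun i => ∑ j, ∑ k, ∫ y, oseenKernel i j k t (x - y) * F y j k

/-- `u` is a strong (mild `L^p`) solution of the Navier--Stokes equations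
`∂_t u + u·∇u + ∇π = Δu`, `∇·u = 0` on `ℝ^d × (0,T)`, `0 < T ≤ ∞`, with initial data `u₀`:
`u ∈ C((0,T); L^p)` is bounded in `L^p` up to the initial time and satisfies Duhamel's formula. -/
structure IsStrongSolution {d : ℕ} (p T : ℝ≥0∞) (u₀ : Vec d → Vec d) (u : ℝ → Vec d → Vec d) :
    Prop where
  memLp : ∀ t : ℝ, 0 < t → ENNReal.ofReal t < T → MemLp (u t) p volume
  continuous : ∀ t : ℝ, 0 < t → ENNReal.ofReal t < T →
    Tendsto (fun s => eLpNorm (u s - u t) p volume) (𝓝 t) (𝓝 0)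
  bounded : ∀ t : ℝ, 0 < t → ENNReal.ofReal t < T →
    ∃ M : ℝ≥0, ∀ s ∈ Set.Ioc 0 t, eLpNorm (u s) p volume ≤ M
  duhamel : ∀ t : ℝ, 0 < t → ENNReal.ofReal t < T → ∀ᵐ x,
    u t x = heatFlow t u₀ x - ∫ s in (0 : ℝ)..t, oseenFlow (t - s) (fun y j k => u s y j * u s y k) x

/-- A Littlewood--Paley function: smooth, radial, supported in the annulus
`3/4 ≤ |ξ| ≤ 8/3`, with `∑_{j ∈ ℤ} φ(2^{-j} ξ) = 1` for `ξ ≠ 0`. -/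
structure IsLittlewoodPaley {d : ℕ} (φ : Vec d → ℝ) : Prop where
  smooth : ContDiff ℝ ∞ φ
  nonneg : ∀ ξ, 0 ≤ φ ξ
  le_one : ∀ ξ, φ ξ ≤ 1
  radial : ∀ ξ η, ‖ξ‖ = ‖η‖ → φ ξ = φ η
  support : ∀ ξ, φ ξ ≠ 0 → 3 / 4 ≤ ‖ξ‖ ∧ ‖ξ‖ ≤ 8 / 3
  partition : ∀ ξ, ξ ≠ 0 → HasSum (fun j : ℤ => φ ((2 : ℝ) ^ (-j) • ξ)) 1

/-- The inverse Fourier transform `h(x) = (2π)^{-d} ∫ e^{i x·ξ} φ(ξ) dξ` of `φ`. It is real since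
`φ` is radial; the rescaling of `φ` accounts for the factor `2π` in Mathlib's exponential. -/
def lpKernel {d : ℕ} (φ : Vec d → ℝ) (x : Vec d) : ℝ :=
  (𝓕⁻ (fun ξ : Vec d => (φ ((2 * Real.pi) • ξ) : ℂ)) x).re

/-- The homogeneous dyadic block `Δ̇_j f = φ(2^{-j} D) f = 2^{jd} h(2^j ·) * f`. -/
def dyadicBlock {d : ℕ} (φ : Vec d → ℝ) (j : ℤ) (f : Vec d → Vec d) (x : Vec d) : Vec d :=
  ∫ y, (((2 : ℝ) ^ j) ^ d * lpKernel φ ((2 : ℝ) ^ j • (x - y))) • f y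

/-- `Δ_{<J} f = ∑_{j < J} Δ̇_j f`. -/
def lowFreq {d : ℕ} (φ : Vec d → ℝ) (J : ℝ) (f : Vec d → Vec d) (x : Vec d) : Vec d :=
  ∑' j : {j : ℤ // (j : ℝ) < J}, dyadicBlock φ j f x

/-- `f ∈ L^p` is `(β,J)`-sparse in frequency in `L^p`: the series defining `Δ_{<J} f` converges
and `‖Δ_{<J} f‖_p ≤ β ‖f‖_p`. -/
def IsFreqSparse {d : ℕ} (φ : Vec d → ℝ) (p : ℝ≥0∞) (β J : ℝ) (f : Vec d → Vec d) : Prop :=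
  MemLp f p volume ∧
  (∀ᵐ x, Summable fun j : {j : ℤ // (j : ℝ) < J} => dyadicBlock φ j f x) ∧
  eLpNorm (lowFreq φ J f) p volume ≤ ENNReal.ofReal β * eLpNorm f p volume

/-- The exponent `μ_p`, given by `1/μ_p = d (1/2 - 1/p)`, where `1/∞ = 0`. -/
def muExp (d : ℕ) (p : ℝ≥0∞) : ℝ := ((d : ℝ) * (1 / 2 - (p⁻¹).toReal))⁻¹

/-- The length scale `ℓ₀ = (‖f‖_2 / ‖f‖_p)^{μ_p}`. -/
def ellZero {d : ℕ} (p : ℝ≥0∞) (f : Vec d → Vec d) : ℝ :=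
  ((eLpNorm f 2 volume).toReal / (eLpNorm f p volume).toReal) ^ muExp d p

end

/-! There are two independent halves.

Low frequencies. If `f ∈ L^2 ∩ L^p` with `p ≥ 2`, Bernstein's inequality gives `‖Δ̇_j f‖_p ≤ H
2^{σj} ‖f‖_2` with `σ = d(1/2 - 1/p) = 1/μ_p` (`eLpNorm_dyadicBlock_le`). For `d ≥ 3` and `p > d`
one has `σ ≥ 1/2`, so the sum over `j < J` is geometric with ratio bounded away from 1 uniformly in
`p`, and is at most `4H 2^{σJ} ‖f‖_2`. The condition on `J`, raised to the power `σ`, makes this at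
most `β ‖f‖_p` (`isFreqSparse_of_ellZero_le`). The dynamics enter only through `u(t) ∈ L^2`.

Persistence of `L^2`. The kernel of `e^{τΔ} ℙ ∇·` is dominated by a superposition of heat kernels,
with mass of order `τ^{-1/2}` and supremum of order `τ^{-1/2-d/2}`. Since `‖u(s)‖_2` is not known to
be finite beforehand, Gronwall cannot be applied to it. It is replaced by the supremum of `∫
ψ|u(s)|` over `ψ ≥ 0` with `∫ ψ^2 ≤ 1` and `∫ ψ^{p'} ≤ R`, where `p'` is the exponent conjugate to
`p`; this is finite by Hölder's inequality and the `L^p` bound. In the Duhamel term one factor `|u|`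
and the kernel are moved onto `ψ`. The map `ψ ↦ |u| (K * ψ)` is bounded on `L^2` and on `L^{p'}`
with the same constant, a multiple of `τ^{-γ}`, `γ = 1/2 + d/(2p)`
(`lintegral_mul_oseenMajorant_rpow_le`), so it preserves the class of test functions up to that
factor. As `γ < 1` exactly when `p > d`, an exponential weight in time absorbs the Duhamel term, and
the resulting bound does not depend on `R` (`lintegral_sq_ne_top_of_duhamel_le`). -/

/-! ### Gaussian bounds for the derivatives of the heat kernel -/

theorem hasFDerivAt_heatKernel {d : ℕ} (t : ℝ) (x : Vec d) :
    HasFDerivAt (heatKernel t) ((-(heatKernel t x) / (2 * t)) • (innerSL ℝ x)) x := by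
  have h1 : HasFDerivAt (fun y : Vec d => ‖y‖ ^ 2) (2 • (innerSL ℝ x)) x :=
    (hasStrictFDerivAt_norm_sq x).hasFDerivAt
  have h2 := ((h1.neg.mul_const ((4 * t)⁻¹)).exp).const_mul ((4 * Real.pi * t) ^ (-(d : ℝ) / 2))
  have h3 : heatKernel t = fun y : Vec d => (4 * Real.pi * t) ^ (-(d : ℝ) / 2) *
      Real.exp ((-fun y => ‖y‖ ^ 2) y * (4 * t)⁻¹) := by
    ext y
    simp [heatKernel, div_eq_mul_inv]
  rw [← h3] at h2
  refine h2.congr_fderiv ?_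
  ext y
  simp [heatKernel, div_eq_mul_inv]
  ring

theorem partialD_heatKernel {d : ℕ} (i : Fin d) (t : ℝ) :
    partialD i (heatKernel (d := d) t) = fun x => -(1 / (2 * t)) * (x i * heatKernel t x) := by
  ext x
  rw [partialD, (hasFDerivAt_heatKernel t x).fderiv]
  simp [EuclideanSpace.inner_single_right]
  ring

theorem contDiff_heatKernel {d : ℕ} (t : ℝ) : ContDiff ℝ ∞ (heatKernel (d := d) t) := by
  unfold heatKernel
  exact contDiff_const.mul (((contDiff_norm_sq ℝ).neg.div_const _).exp)

theorem partialD_const_mul {d : ℕ} (i : Fin d) (c : ℝ) (f : Vec d → ℝ) (hf : Differentiable ℝ f) :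
    partialD i (fun x => c * f x) = fun x => c * partialD i f x := by
  ext x
  simp [partialD, fderiv_const_mul (hf x)]

theorem partialD_add {d : ℕ} (i : Fin d) (f g : Vec d → ℝ) (hf : Differentiable ℝ f)
    (hg : Differentiable ℝ g) :
    partialD i (fun x => f x + g x) = fun x => partialD i f x + partialD i g x := by
  ext x
  simp [partialD, fderiv_fun_add (hf x) (hg x)]

theorem partialD_coord_mul {d : ℕ} (i j : Fin d) (f : Vec d → ℝ) (hf : Differentiable ℝ f) :
    partialD i (fun x => x j * f x) =
      fun x => (if i = j then 1 else 0) * f x + x j * partialD i f x := by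
  ext x
  have h : HasFDerivAt (fun x : Vec d => x j) (EuclideanSpace.proj j : Vec d →L[ℝ] ℝ) x :=
    (EuclideanSpace.proj j : Vec d →L[ℝ] ℝ).hasFDerivAt
  rw [partialD, (h.fun_mul (hf x).hasFDerivAt).fderiv]
  simp [partialD, eq_comm]
  split_ifs <;> ring

theorem partialD_partialD_heatKernel {d : ℕ} (i j : Fin d) (t : ℝ) :
    partialD i (partialD j (heatKernel (d := d) t)) = fun x =>
      -(1 / (2 * t)) * ((if i = j then 1 else 0) * heatKernel t x) +
        (1 / (2 * t)) ^ 2 * (x i * (x j * heatKernel t x)) := by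
  have hG : Differentiable ℝ (heatKernel (d := d) t) :=
    (contDiff_heatKernel t).differentiable (by simp)
  rw [partialD_heatKernel, partialD_const_mul _ _ _ (by fun_prop), partialD_coord_mul _ _ _ hG,
    partialD_heatKernel]
  ext x
  ring

theorem partialD_partialD_partialD_heatKernel {d : ℕ} (i j k : Fin d) (t : ℝ) :
    partialD i (partialD j (partialD k (heatKernel (d := d) t))) = fun x =>
      ((1 / (2 * t)) ^ 2 * ((if j = k then x i else 0) + (if i = j then x k else 0) +
        (if i = k then x j else 0)) - (1 / (2 * t)) ^ 3 * (x i * x j * x k)) * heatKernel t x := by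
  have hG : Differentiable ℝ (heatKernel (d := d) t) :=
    (contDiff_heatKernel t).differentiable (by simp)
  rw [partialD_partialD_heatKernel, partialD_add _ _ _ (by fun_prop) (by fun_prop),
    partialD_const_mul _ _ _ (by fun_prop), partialD_const_mul _ _ _ (by fun_prop),
    partialD_const_mul _ _ _ (by fun_prop),
    partialD_coord_mul _ _ _ (by fun_prop), partialD_coord_mul _ _ _ (by fun_prop),
    partialD_heatKernel]
  ext x
  split_ifs <;> ring

theorem heatKernel_nonneg {d : ℕ} {t : ℝ} (ht : 0 ≤ t) (x : Vec d) : 0 ≤ heatKernel t x := by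
  unfold heatKernel
  positivity

theorem heatKernel_le {d : ℕ} {t : ℝ} (ht : 0 < t) (x : Vec d) :
    heatKernel t x ≤ t ^ (-(d : ℝ) / 2) := by
  unfold heatKernel
  have h1 : Real.exp (-‖x‖ ^ 2 / (4 * t)) ≤ 1 := by
    rw [Real.exp_le_one_iff]
    exact div_nonpos_of_nonpos_of_nonneg (by nlinarith [sq_nonneg ‖x‖]) (by positivity)
  have h2 : (4 * Real.pi * t) ^ (-(d : ℝ) / 2) ≤ t ^ (-(d : ℝ) / 2) := by
    apply Real.rpow_le_rpow_of_nonpos ht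
    · nlinarith [Real.pi_gt_three]
    · exact div_nonpos_of_nonpos_of_nonneg (by simp) (by norm_num)
  calc _ ≤ t ^ (-(d : ℝ) / 2) * 1 := by gcongr
    _ = _ := mul_one _

theorem integrable_heatKernel {d : ℕ} {t : ℝ} (ht : 0 < t) :
    Integrable (heatKernel (d := d) t) ∧ ∫ x, heatKernel (d := d) t x = 1 := by
  have hb : 0 < (4 * t)⁻¹ := by positivity
  have h1 : ∀ x : Vec d, heatKernel t x =
      (4 * Real.pi * t) ^ (-(d : ℝ) / 2) * Real.exp (-(4 * t)⁻¹ * ‖x‖ ^ 2) := by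
    intro x
    unfold heatKernel
    congr 2
    field_simp
  have h2 := GaussianFourier.integral_rexp_neg_mul_sq_norm (V := Vec d) hb
  have h3 : ∫ x, heatKernel (d := d) t x = 1 := by
    simp_rw [h1, integral_const_mul, h2]
    rw [finrank_euclideanSpace_fin, show Real.pi / (4 * t)⁻¹ = 4 * Real.pi * t by
      field_simp, ← Real.rpow_add (by positivity)]
    simp [neg_div]
  refine ⟨?_, h3⟩
  -- A non-integrable function has Bochner integral 0, so the value 1 forces integrability.
  by_contra h
  rw [integral_undef h] at h3
  norm_num at h3

theorem lintegral_heatKernel {d : ℕ} {t : ℝ} (ht : 0 < t) :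
    ∫⁻ x : Vec d, ENNReal.ofReal (heatKernel t x) = 1 := by
  rw [← ofReal_integral_eq_lintegral_ofReal (integrable_heatKernel ht).1
    (ae_of_all _ fun x => heatKernel_nonneg ht.le x), (integrable_heatKernel ht).2]
  simp

/-- Half of the Gaussian exponent is traded for a doubled time. The factor `exp(-|x|²/(8t))` thus
released absorbs the polynomials produced by differentiation. -/
theorem heatKernel_eq_two_mul {d : ℕ} {t : ℝ} (ht : 0 < t) (x : Vec d) :
    heatKernel t x =
      2 ^ ((d : ℝ) / 2) * Real.exp (-(‖x‖ ^ 2 / (8 * t))) * heatKernel (2 * t) x := by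
  unfold heatKernel
  rw [show 4 * Real.pi * (2 * t) = 2 * (4 * Real.pi * t) by ring,
    Real.mul_rpow (x := 2) (by norm_num) (by have := Real.pi_pos; positivity)]
  have h2 : (2 : ℝ) ^ ((d : ℝ) / 2) * 2 ^ (-(d : ℝ) / 2) = 1 := by
    rw [← Real.rpow_add (by norm_num)]; simp [neg_div]
  have h3 : Real.exp (-‖x‖ ^ 2 / (4 * t)) =
      Real.exp (-(‖x‖ ^ 2 / (8 * t))) * Real.exp (-‖x‖ ^ 2 / (4 * (2 * t))) := by
    rw [← Real.exp_add]
    congr 1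
    field_simp
    ring
  rw [h3]
  linear_combination (-(4 * Real.pi * t) ^ (-(d : ℝ) / 2) * Real.exp (-(‖x‖ ^ 2 / (8 * t))) *
    Real.exp (-‖x‖ ^ 2 / (4 * (2 * t)))) * h2

/-- Polynomial factors are absorbed by half of the exponent of a Gaussian. -/
theorem pow_mul_exp_neg_sq_le (z : ℝ) :
    z * Real.exp (-(z ^ 2 / 8)) ≤ 9 ∧ z ^ 3 * Real.exp (-(z ^ 2 / 8)) ≤ 129 := by
  -- The lower bound `1 + w + w²/2 ≤ e^w` at `w = z²/8` suffices; the constants 9 and 129 are not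
  -- sharp.
  have hq := Real.quadratic_le_exp_of_nonneg (x := z ^ 2 / 8) (by positivity)
  have hpos := Real.exp_pos (z ^ 2 / 8)
  rw [Real.exp_neg, ← div_eq_mul_inv, ← div_eq_mul_inv, div_le_iff₀ hpos, div_le_iff₀ hpos]
  constructor
  · nlinarith [sq_nonneg (z - 1), sq_nonneg (z ^ 2)]
  · nlinarith [sq_nonneg (z - 1), sq_nonneg (z ^ 2 - z), sq_nonneg (z ^ 2), sq_nonneg (z^2-1)]

theorem abs_coord_le {d : ℕ} (x : Vec d) (i : Fin d) : |x i| ≤ ‖x‖ :=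
  (Real.norm_eq_abs _).symm.le.trans (PiLp.norm_apply_le x i)

/-- With `s = √t` the parabolic scaling is polynomial: the kernel bounds become bounds in `z = |x| /
s`. -/
theorem sqrt_scaling {t : ℝ} (ht : 0 < t) (r : ℝ) :
    ∃ s : ℝ, 0 < s ∧ s ^ 2 = t ∧ t ^ (-(1 : ℝ) / 2) = s⁻¹ ∧ t ^ (-(3 : ℝ) / 2) = (s ^ 3)⁻¹ ∧
      r = s * (r / s) := by
  refine ⟨Real.sqrt t, Real.sqrt_pos.2 ht, Real.sq_sqrt ht.le, ?_, ?_, ?_⟩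
  · rw [neg_div, Real.rpow_neg ht.le, Real.sqrt_eq_rpow]
  · rw [neg_div, Real.rpow_neg ht.le, Real.sqrt_eq_rpow, ← Real.rpow_natCast, ← Real.rpow_mul ht.le]
    norm_num
  · have := Real.sqrt_pos.2 ht
    field_simp

theorem abs_partialD_heatKernel_le {d : ℕ} (i : Fin d) {t : ℝ} (ht : 0 < t) (x : Vec d) :
    |partialD i (heatKernel t) x| ≤
      (200 * 2 ^ ((d : ℝ) / 2)) * (t ^ (-(1 : ℝ) / 2) * heatKernel (2 * t) x) := by
  obtain ⟨s, hs, hst, h1, -, hr⟩ := sqrt_scaling ht ‖x‖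
  set z := ‖x‖ / s with hz
  have hz0 : 0 ≤ z := by positivity
  have hb := (pow_mul_exp_neg_sq_le z).1
  have hxi := abs_coord_le x i
  have hG := heatKernel_nonneg (by positivity : 0 ≤ 2 * t) x
  rw [partialD_heatKernel]
  dsimp only
  rw [heatKernel_eq_two_mul ht, h1, ← hst, show ‖x‖ ^ 2 / (8 * s ^ 2) = z ^ 2 / 8 by
    rw [hz]; field_simp, hst, abs_mul, abs_mul, abs_neg, abs_of_nonneg (by positivity : 0 ≤ 1 / (2 * t)),
    abs_of_nonneg (by positivity :
      0 ≤ 2 ^ ((d : ℝ) / 2) * Real.exp (-(z ^ 2 / 8)) * heatKernel (2 * t) x)]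
  calc _ ≤ 1 / (2 * t) * (‖x‖ * (2 ^ ((d : ℝ) / 2) * Real.exp (-(z ^ 2 / 8)) * heatKernel (2 * t) x)) := by
        gcongr
    _ = (s⁻¹ * 2 ^ ((d : ℝ) / 2) * heatKernel (2 * t) x / 2) * (z * Real.exp (-(z ^ 2 / 8))) := by
        rw [hr, ← hst]; field_simp
    _ ≤ (s⁻¹ * 2 ^ ((d : ℝ) / 2) * heatKernel (2 * t) x / 2) * 9 := by gcongr
    _ ≤ (s⁻¹ * 2 ^ ((d : ℝ) / 2) * heatKernel (2 * t) x) * 200 := by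
        have : 0 ≤ s⁻¹ * 2 ^ ((d : ℝ) / 2) * heatKernel (2 * t) x := by positivity
        linarith
    _ = _ := by ring

theorem abs_partialD_partialD_partialD_heatKernel_le {d : ℕ} (i j k : Fin d) {t : ℝ} (ht : 0 < t)
    (x : Vec d) :
    |partialD i (partialD j (partialD k (heatKernel t))) x| ≤
      (200 * 2 ^ ((d : ℝ) / 2)) * (t ^ (-(3 : ℝ) / 2) * heatKernel (2 * t) x) := by
  obtain ⟨s, hs, hst, -, h1, hr⟩ := sqrt_scaling ht ‖x‖
  set z := ‖x‖ / s with hz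
  have hz0 : 0 ≤ z := by positivity
  obtain ⟨hb1, hb3⟩ := pow_mul_exp_neg_sq_le z
  have hG := heatKernel_nonneg (by positivity : 0 ≤ 2 * t) x
  have hxi := abs_coord_le x i
  have hxj := abs_coord_le x j
  have hxk := abs_coord_le x k
  have h3 : |(if j = k then x i else 0) + (if i = j then x k else 0) + (if i = k then x j else 0)|
      ≤ 3 * ‖x‖ := by
    have aux : ∀ (P : Prop) [Decidable P] (r : ℝ), |r| ≤ ‖x‖ → |if P then r else 0| ≤ ‖x‖ := by
      intro P _ r hr
      split_ifs
      · exact hr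
      · simp
    have a1 := aux (j = k) _ hxi
    have a2 := aux (i = j) _ hxk
    have a3 := aux (i = k) _ hxj
    refine (abs_add_le _ _).trans ?_
    have := abs_add_le (if j = k then x i else 0) (if i = j then x k else 0)
    linarith
  have h4 : |x i * x j * x k| ≤ ‖x‖ ^ 3 := by
    rw [abs_mul, abs_mul, pow_succ, sq]
    gcongr
  rw [partialD_partialD_partialD_heatKernel]
  dsimp only
  rw [heatKernel_eq_two_mul ht, h1, ← hst, show ‖x‖ ^ 2 / (8 * s ^ 2) = z ^ 2 / 8 by
    rw [hz]; field_simp, hst, abs_mul,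
    abs_of_nonneg (by positivity :
      0 ≤ 2 ^ ((d : ℝ) / 2) * Real.exp (-(z ^ 2 / 8)) * heatKernel (2 * t) x)]
  calc _ ≤ ((1 / (2 * t)) ^ 2 * (3 * ‖x‖) + (1 / (2 * t)) ^ 3 * ‖x‖ ^ 3) *
        (2 ^ ((d : ℝ) / 2) * Real.exp (-(z ^ 2 / 8)) * heatKernel (2 * t) x) := by
        gcongr
        refine (abs_sub _ _).trans ?_
        rw [abs_mul, abs_mul, abs_of_nonneg (by positivity : 0 ≤ (1 / (2 * t)) ^ 2),
          abs_of_nonneg (by positivity : 0 ≤ (1 / (2 * t)) ^ 3)]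
        gcongr
    _ = ((s ^ 3)⁻¹ * 2 ^ ((d : ℝ) / 2) * heatKernel (2 * t) x) *
        (3 / 4 * (z * Real.exp (-(z ^ 2 / 8))) + 1 / 8 * (z ^ 3 * Real.exp (-(z ^ 2 / 8)))) := by
        rw [hr, ← hst]; field_simp; ring
    _ ≤ ((s ^ 3)⁻¹ * 2 ^ ((d : ℝ) / 2) * heatKernel (2 * t) x) * 200 := by
        gcongr
        linarith
    _ = _ := by ring

/-! ### Mass and supremum of a majorant of the Oseen kernel -/

/-- An explicit majorant of the kernel of `e^{tΔ} ℙ ∇·`: a superposition of heat kernels. -/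
noncomputable def oseenMajorant {d : ℕ} (t : ℝ) (x : Vec d) : ℝ≥0∞ :=
  ENNReal.ofReal (200 * 2 ^ ((d : ℝ) / 2)) *
    (ENNReal.ofReal (t ^ (-(1 : ℝ) / 2)) * ENNReal.ofReal (heatKernel (2 * t) x) +
      ∫⁻ s, if t < s then ENNReal.ofReal (s ^ (-(3 : ℝ) / 2)) * ENNReal.ofReal (heatKernel (2 * s) x)
        else 0)

theorem measurable_heatKernel {d : ℕ} :
    Measurable fun q : ℝ × Vec d => heatKernel q.1 q.2 := by
  unfold heatKernel
  fun_prop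

theorem measurable_oseenMajorant {d : ℕ} :
    Measurable fun q : ℝ × Vec d => oseenMajorant q.1 q.2 := by
  have hG : Measurable fun q : ℝ × Vec d => ENNReal.ofReal (heatKernel (2 * q.1) q.2) :=
    (measurable_heatKernel.comp (by fun_prop : Measurable fun q : ℝ × Vec d =>
      (2 * q.1, q.2))).ennreal_ofReal
  have hS : Measurable fun w : (ℝ × Vec d) × ℝ =>
      if w.1.1 < w.2 then ENNReal.ofReal (w.2 ^ (-(3 : ℝ) / 2)) *
        ENNReal.ofReal (heatKernel (2 * w.2) w.1.2) else 0 := by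
    refine Measurable.ite (measurableSet_lt (by fun_prop) (by fun_prop)) ?_ measurable_const
    have hT : Measurable fun w : (ℝ × Vec d) × ℝ => ENNReal.ofReal (w.2 ^ (-(3 : ℝ) / 2)) := by
      fun_prop
    exact hT.mul (hG.comp (by fun_prop : Measurable fun w : (ℝ × Vec d) × ℝ => (w.2, w.1.2)))
  unfold oseenMajorant
  have hT : Measurable fun q : ℝ × Vec d => ENNReal.ofReal (q.1 ^ (-(1 : ℝ) / 2)) := by fun_prop
  refine Measurable.const_mul (Measurable.add (hT.mul hG) ?_) _
  exact hS.lintegral_prod_right'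

theorem enorm_oseenKernel_le {d : ℕ} (i j k : Fin d) {t : ℝ} (ht : 0 < t) (x : Vec d) :
    ‖oseenKernel i j k t x‖ₑ ≤ oseenMajorant t x := by
  unfold oseenKernel oseenMajorant
  refine (enorm_add_le _ _).trans ?_
  rw [mul_add]
  gcongr
  · have h : |if i = j then partialD k (heatKernel t) x else 0| ≤
        (200 * 2 ^ ((d : ℝ) / 2)) * (t ^ (-(1 : ℝ) / 2) * heatKernel (2 * t) x) := by
      split_ifs
      · exact abs_partialD_heatKernel_le k ht x
      · have := heatKernel_nonneg (by positivity : 0 ≤ 2 * t) x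
        rw [abs_zero]
        positivity
    rw [← ENNReal.ofReal_mul (by positivity), ← ENNReal.ofReal_mul (by positivity),
      Real.enorm_eq_ofReal_abs]
    exact ENNReal.ofReal_le_ofReal h
  · refine (enorm_integral_le_lintegral_enorm _).trans ?_
    rw [← lintegral_const_mul' _ _ ENNReal.ofReal_ne_top, ← lintegral_indicator measurableSet_Ioi]
    refine lintegral_mono fun s => ?_
    by_cases hs : t < s
    · have hs0 : 0 < s := ht.trans hs
      rw [Set.indicator_of_mem (Set.mem_Ioi.2 hs), if_pos hs,
        ← ENNReal.ofReal_mul (by positivity), ← ENNReal.ofReal_mul (by positivity),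
        Real.enorm_eq_ofReal_abs]
      exact ENNReal.ofReal_le_ofReal (abs_partialD_partialD_partialD_heatKernel_le i j k hs0 x)
    · rw [Set.indicator_of_notMem (by simpa using hs)]
      exact zero_le

theorem lintegral_rpow_neg_three_halves {t : ℝ} (ht : 0 < t) :
    ∫⁻ s, (if t < s then ENNReal.ofReal (s ^ (-(3 : ℝ) / 2)) else 0) =
      2 * ENNReal.ofReal (t ^ (-(1 : ℝ) / 2)) := by
  have h1 : (fun s => if t < s then ENNReal.ofReal (s ^ (-(3 : ℝ) / 2)) else 0) =
      (Set.Ioi t).indicator fun s => ENNReal.ofReal (s ^ (-(3 : ℝ) / 2)) := by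
    ext s
    simp [Set.indicator_apply]
  rw [h1, lintegral_indicator measurableSet_Ioi, ← ofReal_integral_eq_lintegral_ofReal
    (integrableOn_Ioi_rpow_of_lt (by norm_num) ht), integral_Ioi_rpow_of_lt (by norm_num) ht]
  · rw [show (-(3 : ℝ) / 2 + 1) = -1 / 2 by norm_num,
      show -t ^ (-(1 : ℝ) / 2) / (-1 / 2) = 2 * t ^ (-(1 : ℝ) / 2) by ring,
      ENNReal.ofReal_mul (by norm_num)]
    simp
  · filter_upwards [ae_restrict_mem measurableSet_Ioi] with s hs
    have : 0 < s := ht.trans hs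
    exact Real.rpow_nonneg this.le _

/-- The constant in the bounds of `oseenMajorant`. -/
noncomputable def oseenConst (d : ℕ) : ℝ≥0∞ := ENNReal.ofReal (200 * 2 ^ ((d : ℝ) / 2)) * 3

theorem oseenConst_ne_top (d : ℕ) : oseenConst d ≠ ⊤ :=
  ENNReal.mul_ne_top ENNReal.ofReal_ne_top (by simp)

/-- Heat kernels have mass 1 and `∫_t^∞ s^{-3/2} ds = 2 t^{-1/2}`; the two terms of the majorant
contribute 1 and 2, whence the 3 in `oseenConst`. -/
theorem lintegral_oseenMajorant_le {d : ℕ} {t : ℝ} (ht : 0 < t) :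
    ∫⁻ x : Vec d, oseenMajorant t x ≤ oseenConst d * ENNReal.ofReal (t ^ (-(1 : ℝ) / 2)) := by
  have hG : Measurable fun q : ℝ × Vec d => ENNReal.ofReal (heatKernel (2 * q.1) q.2) :=
    (measurable_heatKernel.comp (by fun_prop : Measurable fun q : ℝ × Vec d =>
      (2 * q.1, q.2))).ennreal_ofReal
  have hGt : ∀ s, Measurable fun x : Vec d => ENNReal.ofReal (heatKernel (2 * s) x) := fun s =>
    hG.comp measurable_prodMk_left
  unfold oseenMajorant oseenConst
  rw [lintegral_const_mul' _ _ ENNReal.ofReal_ne_top, lintegral_add_left ((hGt t).const_mul _),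
    lintegral_const_mul' _ _ ENNReal.ofReal_ne_top, lintegral_heatKernel (by positivity),
    lintegral_lintegral_swap]
  · have h : ∀ s, ∫⁻ x : Vec d, (if t < s then ENNReal.ofReal (s ^ (-(3 : ℝ) / 2)) *
        ENNReal.ofReal (heatKernel (2 * s) x) else 0) =
        if t < s then ENNReal.ofReal (s ^ (-(3 : ℝ) / 2)) else 0 := by
      intro s
      split_ifs with hs
      · have : 0 < s := ht.trans hs
        rw [lintegral_const_mul' _ _ ENNReal.ofReal_ne_top, lintegral_heatKernel (by positivity),
          mul_one]
      · simp
    simp_rw [h]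
    rw [lintegral_rpow_neg_three_halves ht, mul_assoc]
    gcongr
    rw [mul_one]
    apply le_of_eq
    ring
  · refine Measurable.aemeasurable ?_
    change Measurable fun w : Vec d × ℝ => if t < w.2 then ENNReal.ofReal (w.2 ^ (-(3 : ℝ) / 2)) *
      ENNReal.ofReal (heatKernel (2 * w.2) w.1) else 0
    refine Measurable.ite (measurableSet_lt (by fun_prop) (by fun_prop)) ?_ measurable_const
    have hT : Measurable fun w : Vec d × ℝ => ENNReal.ofReal (w.2 ^ (-(3 : ℝ) / 2)) := by fun_prop
    have hG' : Measurable fun w : Vec d × ℝ => ENNReal.ofReal (heatKernel (2 * w.2) w.1) := by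
      unfold heatKernel
      fun_prop
    exact hT.mul hG'

/-- Every heat kernel in the superposition has time at least `2t`, so all are bounded by `t^{-d/2}`,
and the time integral is the one in the mass estimate. -/
theorem oseenMajorant_le {d : ℕ} {t : ℝ} (ht : 0 < t) (x : Vec d) :
    oseenMajorant t x ≤ oseenConst d * ENNReal.ofReal (t ^ (-(1 : ℝ) / 2)) *
      ENNReal.ofReal (t ^ (-(d : ℝ) / 2)) := by
  have hG : ∀ s, t ≤ s → ENNReal.ofReal (heatKernel (2 * s) x) ≤
      ENNReal.ofReal (t ^ (-(d : ℝ) / 2)) := by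
    intro s hs
    have hs0 : 0 < s := ht.trans_le hs
    refine ENNReal.ofReal_le_ofReal ((heatKernel_le (by positivity) x).trans ?_)
    refine Real.rpow_le_rpow_of_nonpos ht (by linarith) ?_
    exact div_nonpos_of_nonpos_of_nonneg (by simp) (by norm_num)
  have hS : (∫⁻ s, if t < s then ENNReal.ofReal (s ^ (-(3 : ℝ) / 2)) *
      ENNReal.ofReal (heatKernel (2 * s) x) else 0) ≤
      2 * ENNReal.ofReal (t ^ (-(1 : ℝ) / 2)) * ENNReal.ofReal (t ^ (-(d : ℝ) / 2)) := by
    rw [← lintegral_rpow_neg_three_halves ht, ← lintegral_mul_const' _ _ ENNReal.ofReal_ne_top]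
    refine lintegral_mono fun s => ?_
    dsimp only
    split_ifs with hs
    · exact mul_le_mul_right (hG s hs.le) _
    · simp
  unfold oseenMajorant oseenConst
  rw [mul_assoc, mul_assoc]
  gcongr
  calc _ ≤ ENNReal.ofReal (t ^ (-(1 : ℝ) / 2)) * ENNReal.ofReal (t ^ (-(d : ℝ) / 2)) +
        2 * ENNReal.ofReal (t ^ (-(1 : ℝ) / 2)) * ENNReal.ofReal (t ^ (-(d : ℝ) / 2)) :=
        add_le_add (mul_le_mul_right (hG t le_rfl) _) hS
    _ = _ := by ring

/-! ### Schur's test with a multiplier in `L^p` -/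

section Schur

variable {α : Type*} [MeasurableSpace α] {μ : Measure α}

/-- Jensen's inequality for a kernel of mass at most `K`. -/
theorem lintegral_mul_rpow_le {k ψ : α → ℝ≥0∞} (hk : Measurable k) (hψ : Measurable ψ)
    {K : ℝ≥0∞} (hK : ∫⁻ x, k x ∂μ ≤ K) {a : ℝ} (ha : 1 ≤ a) :
    (∫⁻ x, k x * ψ x ∂μ) ^ a ≤ K ^ (a - 1) * ∫⁻ x, k x * ψ x ^ a ∂μ := by
  have ha0 : 0 < a := by linarith
  have hinv : a⁻¹ ≤ 1 := inv_le_one_of_one_le₀ ha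
  -- Hölder's inequality with `k = k^{1-1/a} k^{1/a}`, the second power being grouped with `ψ`.
  have h := ENNReal.lintegral_mul_norm_pow_le (μ := μ) hk.aemeasurable
    (hk.mul (hψ.pow_const a)).aemeasurable (p := 1 - a⁻¹) (q := a⁻¹) (by linarith) (by positivity)
    (by ring)
  have heq : ∀ x, k x ^ (1 - a⁻¹) * (k x * ψ x ^ a) ^ a⁻¹ = k x * ψ x := by
    intro x
    rw [ENNReal.mul_rpow_of_nonneg _ _ (by positivity), ← mul_assoc,
      ← ENNReal.rpow_add_of_nonneg _ _ (by linarith) (by positivity), ← ENNReal.rpow_mul,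
      mul_inv_cancel₀ ha0.ne']
    simp
  simp only [Pi.mul_apply, heq] at h
  calc _ ≤ ((∫⁻ x, k x ∂μ) ^ (1 - a⁻¹) * (∫⁻ x, k x * ψ x ^ a ∂μ) ^ a⁻¹) ^ a := by gcongr
    _ = (∫⁻ x, k x ∂μ) ^ (a - 1) * ∫⁻ x, k x * ψ x ^ a ∂μ := by
      rw [ENNReal.mul_rpow_of_nonneg _ _ ha0.le, ← ENNReal.rpow_mul, ← ENNReal.rpow_mul,
        inv_mul_cancel₀ ha0.ne', sub_mul, inv_mul_cancel₀ ha0.ne']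
      simp
    _ ≤ _ := by gcongr

variable [SFinite μ]

theorem lintegral_lintegral_kernel_le {k : α → α → ℝ≥0∞} (hk : Measurable (Function.uncurry k))
    {ψ : α → ℝ≥0∞} (hψ : Measurable ψ) {K : ℝ≥0∞} (hK : ∀ x, ∫⁻ y, k x y ∂μ ≤ K) :
    ∫⁻ y, ∫⁻ x, k x y * ψ x ∂μ ∂μ ≤ K * ∫⁻ x, ψ x ∂μ := by
  rw [lintegral_lintegral_swap]
  · rw [← lintegral_const_mul _ hψ]
    refine lintegral_mono fun x => ?_
    dsimp only
    have hkx : Measurable fun y => k x y := hk.comp measurable_prodMk_left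
    rw [lintegral_mul_const _ hkx]
    gcongr
    exact hK x
  · exact ((hk.comp measurable_swap).mul (hψ.comp measurable_snd)).aemeasurable

/-- Schur's test followed by Hölder's inequality: multiplication by `U ∈ L^p` after a bounded
kernel operator is bounded on `L^a` for `1 ≤ a ≤ p`. -/
theorem lintegral_mul_kernel_rpow_le {k : α → α → ℝ≥0∞} (hk : Measurable (Function.uncurry k))
    {U ψ : α → ℝ≥0∞} (hU : Measurable U) (hψ : Measurable ψ) {K L : ℝ≥0∞}
    (hK : ∀ y, ∫⁻ x, k x y ∂μ ≤ K) (hK' : ∀ x, ∫⁻ y, k x y ∂μ ≤ K) (hL : ∀ x y, k x y ≤ L)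
    {p : ℝ≥0∞} {a : ℝ} (ha : 1 ≤ a) (hap : ENNReal.ofReal a ≤ p) :
    ∫⁻ y, (U y * ∫⁻ x, k x y * ψ x ∂μ) ^ a ∂μ ≤
      (eLpNorm U p μ * K ^ (1 - (p⁻¹).toReal) * L ^ (p⁻¹).toReal) ^ a * ∫⁻ x, ψ x ^ a ∂μ := by
  have ha0 : 0 < a := by linarith
  have hψa : Measurable fun x => ψ x ^ a := hψ.pow_const a
  set S := ∫⁻ x, ψ x ^ a ∂μ
  set h : α → ℝ≥0∞ := fun y => ∫⁻ x, k x y * ψ x ^ a ∂μ with hh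
  have hhm : Measurable h :=
    ((hk.comp measurable_swap).mul (hψa.comp measurable_snd)).lintegral_prod_right'
  have hh1 : ∫⁻ y, h y ∂μ ≤ K * S := lintegral_lintegral_kernel_le hk hψa hK'
  have hh2 : ∀ y, h y ≤ L * S := by
    intro y
    rw [← lintegral_const_mul _ hψa]
    refine lintegral_mono fun x => ?_
    dsimp only
    gcongr
    exact hL x y
  have hstep : ∫⁻ y, (U y * ∫⁻ x, k x y * ψ x ∂μ) ^ a ∂μ ≤
      K ^ (a - 1) * ∫⁻ y, U y ^ a * h y ∂μ := by
    rw [← lintegral_const_mul _ (by fun_prop : Measurable fun y => U y ^ a * h y)]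
    refine lintegral_mono fun y => ?_
    dsimp only
    rw [ENNReal.mul_rpow_of_nonneg _ _ ha0.le]
    calc _ ≤ U y ^ a * (K ^ (a - 1) * h y) := by
          gcongr
          exact lintegral_mul_rpow_le (hk.comp measurable_prodMk_right) hψ (hK y) ha
      _ = _ := by ring
  refine hstep.trans ?_
  rcases eq_or_ne p ∞ with rfl | hp
  · have hUN : ∀ᵐ y ∂μ, U y ≤ eLpNorm U ∞ μ := by
      filter_upwards [ae_le_eLpNormEssSup (f := U) (μ := μ)] with y hy
      simpa using hy
    calc _ ≤ K ^ (a - 1) * ∫⁻ y, eLpNorm U ∞ μ ^ a * h y ∂μ := by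
          gcongr 1
          refine lintegral_mono_ae ?_
          filter_upwards [hUN] with y hy
          gcongr
      _ ≤ K ^ (a - 1) * (eLpNorm U ∞ μ ^ a * (K * S)) := by
          rw [lintegral_const_mul _ hhm]
          gcongr
      _ = (K ^ (a - 1) * K ^ (1 : ℝ)) * eLpNorm U ∞ μ ^ a * S := by
          rw [ENNReal.rpow_one]; ring
      _ = _ := by
          rw [← ENNReal.rpow_add_of_nonneg _ _ (by linarith) (by norm_num)]
          simp [ENNReal.mul_rpow_of_nonneg _ _ ha0.le, mul_comm]
  · have har : a ≤ p.toReal := (ENNReal.ofReal_le_iff_le_toReal hp).1 hap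
    set r := p.toReal with hr
    have hr0 : 0 < r := by linarith
    have hp0 : p ≠ 0 := by rintro rfl; simp at hr; linarith
    set θ := a / r with hθ
    have hθ0 : 0 < θ := by positivity
    have hθ1 : θ ≤ 1 := (div_le_one hr0).2 har
    have hholder := ENNReal.lintegral_mul_norm_pow_le (μ := μ) (hU.pow_const r).aemeasurable
      hhm.aemeasurable (p := θ) (q := 1 - θ) hθ0.le (by linarith) (by ring)
    -- With `θ = a/r`, the power `h^θ` is estimated by its supremum `L S`, and Hölder's inequality
    -- is applied to what remains. The powers `K^{a-θ} L^θ` then have `a`-th roots `K^{1-1/p}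
    -- L^{1/p}`, independent of `a`.
    have hpt : ∀ y, U y ^ a * h y ≤ (L * S) ^ θ * ((U y ^ r) ^ θ * h y ^ (1 - θ)) := by
      intro y
      have e1 : U y ^ a = (U y ^ r) ^ θ := by
        rw [← ENNReal.rpow_mul, hθ, mul_div_cancel₀ _ hr0.ne']
      have e2 : h y = h y ^ θ * h y ^ (1 - θ) := by
        rw [← ENNReal.rpow_add_of_nonneg _ _ hθ0.le (by linarith)]
        simp
      calc _ = (U y ^ r) ^ θ * (h y ^ θ * h y ^ (1 - θ)) := by rw [← e1, ← e2]
        _ ≤ (U y ^ r) ^ θ * ((L * S) ^ θ * h y ^ (1 - θ)) := by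
            gcongr
            exact hh2 y
        _ = _ := by ring
    have hN : eLpNorm U p μ ^ a = (∫⁻ y, U y ^ r ∂μ) ^ θ := by
      rw [eLpNorm_eq_lintegral_rpow_enorm_toReal hp0 hp, ← ENNReal.rpow_mul]
      simp [hθ, hr, div_eq_inv_mul]
    have hpi : (p⁻¹).toReal = r⁻¹ := by rw [ENNReal.toReal_inv]
    calc _ ≤ K ^ (a - 1) * ((L * S) ^ θ * ∫⁻ y, (U y ^ r) ^ θ * h y ^ (1 - θ) ∂μ) := by
          gcongr 1
          rw [← lintegral_const_mul _ (by fun_prop :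
            Measurable fun y => (U y ^ r) ^ θ * h y ^ (1 - θ))]
          exact lintegral_mono hpt
      _ ≤ K ^ (a - 1) * ((L * S) ^ θ * ((∫⁻ y, U y ^ r ∂μ) ^ θ * (K * S) ^ (1 - θ))) := by
          gcongr
          refine hholder.trans ?_
          gcongr
      _ = (∫⁻ y, U y ^ r ∂μ) ^ θ * (K ^ (a - 1) * K ^ (1 - θ)) * L ^ θ * (S ^ θ * S ^ (1 - θ)) := by
          rw [ENNReal.mul_rpow_of_nonneg _ _ hθ0.le, ENNReal.mul_rpow_of_nonneg _ _ (by linarith)]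
          ring
      _ = (∫⁻ y, U y ^ r ∂μ) ^ θ * K ^ (a - θ) * L ^ θ * S := by
          rw [← ENNReal.rpow_add_of_nonneg _ _ (by linarith) (by linarith),
            ← ENNReal.rpow_add_of_nonneg _ _ hθ0.le (by linarith)]
          simp
      _ = _ := by
          rw [ENNReal.mul_rpow_of_nonneg _ _ ha0.le, ENNReal.mul_rpow_of_nonneg _ _ ha0.le, hN, hpi,
            ← ENNReal.rpow_mul, ← ENNReal.rpow_mul]
          congr 4
          · rw [hθ]; field_simp
          · rw [hθ]; field_simp

end Schur

/-! ### Joint measurability of continuous paths in `L^p` -/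

section JointMeasurability

variable {α E : Type*} [MeasurableSpace α] {μ : Measure α} [NormedAddCommGroup E] [CompleteSpace E]

/-- A sequence converging in `L^p` at a geometric rate converges almost everywhere. -/
theorem ae_tendsto_of_eLpNorm_sub_lt {p : ℝ≥0∞} (hp : 1 ≤ p) {f : ℕ → α → E} {g : α → E}
    (hf : ∀ n, AEStronglyMeasurable (f n) μ) (hg : AEStronglyMeasurable g μ)
    (h : ∀ n, eLpNorm (f n - g) p μ < 2⁻¹ ^ n) :
    ∀ᵐ x ∂μ, Tendsto (fun n => f n x) atTop (𝓝 (g x)) := by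
  have hmono : ∀ {N n : ℕ}, N ≤ n → (2⁻¹ : ℝ≥0∞) ^ n ≤ 2⁻¹ ^ N := fun hn =>
    pow_le_pow_right_of_le_one' (by simp) hn
  have hcau : ∀ᵐ x ∂μ, ∃ l : E, atTop.Tendsto (fun n => f n x) (𝓝 l) := by
    refine Lp.ae_tendsto_of_cauchy_eLpNorm hf hp (B := fun n => 2⁻¹ ^ n + 2⁻¹ ^ n) ?_ ?_
    · rw [ENNReal.tsum_add, ENNReal.tsum_geometric]
      simp
    · intro N n m hn hm
      have e : f n - f m = (f n - g) - (f m - g) := by abel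
      rw [e]
      refine (eLpNorm_sub_le ((hf n).sub hg) ((hf m).sub hg) hp).trans_lt ?_
      exact ENNReal.add_lt_add ((h n).trans_le (hmono hn)) ((h m).trans_le (hmono hm))
  -- The almost everywhere limit exists by the Cauchy property; convergence in measure identifies it
  -- with `g` along a subsequence.
  have hmeas : TendstoInMeasure μ f atTop g := by
    refine tendstoInMeasure_of_tendsto_eLpNorm (zero_lt_one.trans_le hp).ne' hf hg ?_
    refine tendsto_of_tendsto_of_tendsto_of_le_of_le tendsto_const_nhds
      (ENNReal.tendsto_pow_atTop_nhds_zero_of_lt_one (r := 2⁻¹) (by simp))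
      (fun _ => zero_le) fun n => (h n).le
  obtain ⟨ns, hns, hlim⟩ := hmeas.exists_seq_tendsto_ae
  filter_upwards [hcau, hlim] with x ⟨l, hl⟩ hx
  rwa [tendsto_nhds_unique hx (hl.comp hns.tendsto_atTop)]

/-- A continuous path in `L^p` has a jointly measurable version of its pointwise norm. -/
theorem exists_measurable_enorm_version {p : ℝ≥0∞} (hp : 1 ≤ p) {I : Set ℝ} (hI : MeasurableSet I)
    {u : ℝ → α → E} (hu : ∀ s ∈ I, MemLp (u s) p μ)
    (hc : ∀ t ∈ I, Tendsto (fun s => eLpNorm (u s - u t) p μ) (𝓝 t) (𝓝 0)) :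
    ∃ U : ℝ → α → ℝ≥0∞, Measurable (Function.uncurry U) ∧
      ∀ s ∈ I, ∀ᵐ x ∂μ, U s x = ‖u s x‖ₑ := by
  classical
  rcases I.eq_empty_or_nonempty with rfl | hne
  · exact ⟨fun _ _ => 0, measurable_const, by simp⟩
  have : Nonempty I := hne.to_subtype
  have : Fact (1 ≤ p) := ⟨hp⟩
  set c : I → Lp E p μ := fun s => (hu s s.2).toLp (u s) with hcdef
  have hedist : ∀ s t : I, edist (c s) (c t) = eLpNorm (u s - u t) p μ := fun s t =>
    Lp.edist_toLp_toLp _ _ _ _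
  have hcont : Continuous c := by
    rw [continuous_iff_continuousAt]
    intro t
    rw [ContinuousAt, tendsto_iff_edist_tendsto_0]
    simp_rw [hedist]
    exact (hc t t.2).comp (continuous_subtype_val.tendsto t)
  set q := TopologicalSpace.denseSeq I
  -- The path is approximated within `2^{-n}` by its values at a dense sequence of times. Taking the
  -- first admissible index makes the choice measurable in `s`, and the approximants, piecewise
  -- constant in time with countably many values, jointly measurable.
  have hex : ∀ (n : ℕ) (s : I), ∃ k, edist (c (q k)) (c s) < 2⁻¹ ^ n := by
    intro n s
    have hopen : IsOpen {t : I | edist (c t) (c s) < 2⁻¹ ^ n} :=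
      isOpen_lt (hcont.edist continuous_const) continuous_const
    obtain ⟨t, ht, k, rfl⟩ := (TopologicalSpace.denseRange_denseSeq I).inter_open_nonempty _ hopen
      ⟨s, by simp [ENNReal.pow_pos]⟩
    exact ⟨k, ht⟩
  have hK : ∀ n : ℕ, Measurable fun s : I => Nat.find (hex n s) := fun n =>
    measurable_find (hex n) fun k =>
      (isOpen_lt (continuous_const.edist hcont) continuous_const).measurableSet
  have hK' : ∀ n : ℕ, ∃ K : ℝ → ℕ, Measurable K ∧ ∀ s : I, K s = Nat.find (hex n s) := by
    intro n
    obtain ⟨K, hKm, hKe⟩ := (MeasurableEmbedding.subtype_coe hI).exists_measurable_extend (hK n)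
      fun _ => ⟨0⟩
    exact ⟨K, hKm, fun s => congrFun hKe s⟩
  choose K hKm hKe using hK'
  choose v hvm hve using fun k => (hu (q k) (q k).2).1
  have hw : Measurable fun z : ℕ × α => ‖v z.1 z.2‖ₑ :=
    measurable_from_prod_countable_right fun k => (hvm k).enorm
  have hwK : ∀ n, Measurable fun z : ℝ × α => ‖v (K n z.1) z.2‖ₑ := by
    intro n
    have hm : Measurable fun z : ℝ × α => (K n z.1, z.2) :=
      ((hKm n).comp measurable_fst).prodMk measurable_snd
    exact hw.comp hm
  -- A `liminf` is measurable whether or not the sequence converges, in particular at times outside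
  -- `I`.
  refine ⟨fun s x => liminf (fun n => ‖v (K n s) x‖ₑ) atTop, ?_, ?_⟩
  · exact Measurable.liminf hwK
  · intro s hs
    have h : ∀ᵐ x ∂μ, Tendsto (fun n => v (K n s) x) atTop (𝓝 (u s x)) := by
      refine ae_tendsto_of_eLpNorm_sub_lt hp (fun n => (hvm _).aestronglyMeasurable) (hu s hs).1
        fun n => ?_
      have hfind := Nat.find_spec (hex n ⟨s, hs⟩)
      rw [← hKe n ⟨s, hs⟩, hedist] at hfind
      rwa [eLpNorm_congr_ae ((hve _).symm.sub (ae_eq_refl _))]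
    filter_upwards [h] with x hx
    exact ((continuous_enorm.tendsto _).comp hx).liminf_eq

end JointMeasurability

/-! ### Duality and membership in `L^2` -/

section Duality

variable {α : Type*} [MeasurableSpace α] {μ : Measure α}

theorem lintegral_mul_le_eLpNorm {ψ U : α → ℝ≥0∞} (hψ : Measurable ψ) (hU : Measurable U)
    {p : ℝ≥0∞} (hp : 1 < p) :
    ∫⁻ x, ψ x * U x ∂μ ≤
      (∫⁻ x, ψ x ^ (1 - (p⁻¹).toReal)⁻¹ ∂μ) ^ (1 - (p⁻¹).toReal) * eLpNorm U p μ := by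
  rcases eq_or_ne p ∞ with rfl | hpt
  · have hUN : ∀ᵐ y ∂μ, U y ≤ eLpNorm U ∞ μ := by
      filter_upwards [ae_le_eLpNormEssSup (f := U) (μ := μ)] with y hy
      simpa using hy
    simp only [ENNReal.inv_top, ENNReal.toReal_zero, sub_zero, inv_one, ENNReal.rpow_one]
    rw [← lintegral_mul_const _ hψ]
    refine lintegral_mono_ae ?_
    filter_upwards [hUN] with y hy
    gcongr
  · have hp0 : p ≠ 0 := (zero_lt_one.trans hp).ne'
    have hr : 1 < p.toReal := by
      rw [← ENNReal.toReal_one]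
      exact (ENNReal.toReal_lt_toReal (by simp) hpt).2 hp
    have hconj : p.toReal.HolderConjugate (1 - (p⁻¹).toReal)⁻¹ := by
      rw [Real.holderConjugate_iff]
      refine ⟨hr, ?_⟩
      rw [ENNReal.toReal_inv]
      simp
    have h := ENNReal.lintegral_mul_le_Lp_mul_Lq μ hconj.symm hψ.aemeasurable hU.aemeasurable
    rw [eLpNorm_eq_lintegral_rpow_enorm_toReal hp0 hpt]
    simpa using h

/-- A function whose pairings with normalised functions of `L^2 ∩ L^a` are bounded lies in
`L^2`. -/
theorem lintegral_sq_le_of_pairing_le {α : Type*} [PseudoMetricSpace α] [Nonempty α]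
    [MeasurableSpace α] [OpensMeasurableSpace α]
    {μ : Measure α} (hμ : ∀ (x : α) (r : ℝ), μ (Metric.closedBall x r) ≠ ⊤)
    {U : α → ℝ≥0∞} (hU : Measurable U) (hfin : ∀ᵐ x ∂μ, U x ≠ ⊤)
    {a : ℝ} (ha : 0 < a) {Q : ℝ≥0∞}
    (hQ : ∀ ψ : α → ℝ≥0∞, Measurable ψ → ∫⁻ x, ψ x ^ (2 : ℝ) ∂μ ≤ 1 →
      ∫⁻ x, ψ x ^ a ∂μ ≠ ⊤ → ∫⁻ x, ψ x * U x ∂μ ≤ Q) :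
    ∫⁻ x, U x ^ (2 : ℝ) ∂μ ≤ Q ^ (2 : ℝ) := by
  obtain ⟨x₀⟩ := ‹Nonempty α›
  -- Truncating `U` in space and in size gives test functions with all powers integrable. Pairing
  -- `U` with its normalised truncation bounds the `L^2` norm of the truncation by `Q`, and Fatou's
  -- lemma removes the cut-off.
  set A : ℕ → Set α := fun n => Metric.closedBall x₀ n ∩ {x | U x ≤ n} with hA
  have hAm : ∀ n, MeasurableSet (A n) := fun n =>
    Metric.isClosed_closedBall.measurableSet.inter (hU measurableSet_Iic)
  set ψ : ℕ → α → ℝ≥0∞ := fun n => (A n).indicator U with hψdef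
  have hψm : ∀ n, Measurable (ψ n) := fun n => hU.indicator (hAm n)
  have hψfin : ∀ n (b : ℝ), 0 < b → ∫⁻ x, ψ n x ^ b ∂μ ≠ ⊤ := by
    intro n b hb
    have hle : ∀ x, ψ n x ^ b ≤ (Metric.closedBall x₀ (n : ℝ)).indicator (fun _ => (n : ℝ≥0∞) ^ b) x := by
      intro x
      by_cases hx : x ∈ A n
      · rw [Set.indicator_of_mem hx.1]
        simp only [hψdef, Set.indicator_of_mem hx]
        gcongr
        exact hx.2
      · simp [hψdef, Set.indicator_of_notMem hx, hb]
    refine ((lintegral_mono hle).trans_lt ?_).ne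
    rw [lintegral_indicator_const Metric.isClosed_closedBall.measurableSet]
    exact ENNReal.mul_lt_top (ENNReal.rpow_lt_top_of_nonneg hb.le (ENNReal.natCast_ne_top n))
      (hμ _ _).lt_top
  have hbound : ∀ n, ∫⁻ x, ψ n x ^ (2 : ℝ) ∂μ ≤ Q ^ (2 : ℝ) := by
    intro n
    set b := ∫⁻ x, ψ n x ^ (2 : ℝ) ∂μ with hb
    have hbt : b ≠ ⊤ := hψfin n 2 two_pos
    rcases eq_or_ne b 0 with hb0 | hb0
    · rw [hb0]; exact zero_le
    -- The factor normalising the truncation in `L^2`.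
    set e := b ^ (-(1 / 2) : ℝ) with he
    have he0 : e ≠ ⊤ := ENNReal.rpow_ne_top_of_ne_zero hb0 hbt
    have hscale : ∀ r : ℝ, 0 ≤ r → ∫⁻ x, (e * ψ n x) ^ r ∂μ = e ^ r * ∫⁻ x, ψ n x ^ r ∂μ := by
      intro r hr
      simp_rw [ENNReal.mul_rpow_of_nonneg _ _ hr]
      rw [lintegral_const_mul _ ((hψm n).pow_const r)]
    have h1 := hQ (fun x => e * ψ n x) ((hψm n).const_mul e) (by
      rw [hscale 2 (by norm_num), ← hb, he, ← ENNReal.rpow_mul]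
      norm_num
      rw [ENNReal.rpow_neg_one, ENNReal.inv_mul_cancel hb0 hbt]) (by
      rw [hscale a ha.le]
      exact ENNReal.mul_ne_top (ENNReal.rpow_ne_top_of_nonneg ha.le he0) (hψfin n a ha))
    have h2 : ∫⁻ x, e * ψ n x * U x ∂μ = e * b := by
      rw [hb, ← lintegral_const_mul _ ((hψm n).pow_const _)]
      refine lintegral_congr fun x => ?_
      rw [mul_assoc]
      by_cases hx : x ∈ A n
      · simp only [hψdef, Set.indicator_of_mem hx]
        rw [ENNReal.rpow_two, sq]
      · simp [hψdef, Set.indicator_of_notMem hx]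
    rw [h2] at h1
    have h3 : e * b = b ^ (1 / 2 : ℝ) := by
      calc e * b = b ^ (-(1 / 2) : ℝ) * b ^ (1 : ℝ) := by rw [ENNReal.rpow_one]
        _ = b ^ (1 / 2 : ℝ) := by
          rw [← ENNReal.rpow_add _ _ hb0 hbt]
          norm_num
    rw [h3] at h1
    calc b = (b ^ (1 / 2 : ℝ)) ^ (2 : ℝ) := by
          rw [← ENNReal.rpow_mul]; norm_num
      _ ≤ _ := by gcongr
  have hlim : ∀ᵐ x ∂μ, U x ^ (2 : ℝ) ≤ liminf (fun n => ψ n x ^ (2 : ℝ)) atTop := by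
    filter_upwards [hfin] with x hx
    refine le_of_eq (Tendsto.liminf_eq ?_).symm
    refine tendsto_const_nhds.congr' ?_
    obtain ⟨n₁, hn₁⟩ := exists_nat_ge (dist x x₀)
    obtain ⟨n₂, hn₂⟩ := ENNReal.exists_nat_gt hx
    filter_upwards [eventually_ge_atTop n₁, eventually_ge_atTop n₂] with n h1 h2
    have hxA : x ∈ A n := by
      refine ⟨hn₁.trans (by exact_mod_cast h1), hn₂.le.trans ?_⟩
      exact_mod_cast h2
    simp only [hψdef, Set.indicator_of_mem hxA]
  calc _ ≤ ∫⁻ x, liminf (fun n => ψ n x ^ (2 : ℝ)) atTop ∂μ := lintegral_mono_ae hlim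
    _ ≤ liminf (fun n => ∫⁻ x, ψ n x ^ (2 : ℝ) ∂μ) atTop :=
        lintegral_liminf_le fun n => (hψm n).pow_const _
    _ ≤ Q ^ (2 : ℝ) := by
        refine (liminf_le_liminf (Eventually.of_forall hbound)).trans ?_
        simp

end Duality

/-! ### The time singularity and the adjoint of the Duhamel operator -/

/-- The Laplace transform of `τ ^ (-γ)`, `γ < 1`, tends to zero at infinity. -/
theorem exists_lintegral_rpow_mul_exp_le {γ : ℝ} (hγ : γ < 1) {c : ℝ≥0∞} (hc : c ≠ ⊤) :
    ∃ l : ℝ, 0 < l ∧ c * ∫⁻ τ in Set.Ioi (0 : ℝ),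
      ENNReal.ofReal (τ ^ (-γ) * Real.exp (-(l * τ))) ≤ 2⁻¹ := by
  have hγ' : 0 < 1 - γ := by linarith
  have hval : ∀ l : ℝ, 0 < l → ∫⁻ τ in Set.Ioi (0 : ℝ),
      ENNReal.ofReal (τ ^ (-γ) * Real.exp (-(l * τ))) =
        ENNReal.ofReal ((1 / l) ^ (1 - γ) * Real.Gamma (1 - γ)) := by
    intro l hl
    have h := Real.integral_rpow_mul_exp_neg_mul_Ioi hγ' hl
    have hpos : 0 < (1 / l) ^ (1 - γ) * Real.Gamma (1 - γ) :=
      mul_pos (by positivity) (Real.Gamma_pos_of_pos hγ')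
    rw [← h, ofReal_integral_eq_lintegral_ofReal]
    · simp
    · by_contra hcon
      rw [integral_undef hcon] at h
      exact hpos.ne h
    · filter_upwards [ae_restrict_mem measurableSet_Ioi] with τ hτ
      have : (0 : ℝ) < τ := hτ
      positivity
  have hlim : Tendsto (fun l : ℝ => c * ENNReal.ofReal ((1 / l) ^ (1 - γ) * Real.Gamma (1 - γ)))
      atTop (𝓝 0) := by
    have h1 : Tendsto (fun l : ℝ => (1 / l) ^ (1 - γ) * Real.Gamma (1 - γ)) atTop (𝓝 0) := by
      have h0 : Tendsto (fun l : ℝ => 1 / l) atTop (𝓝 0) := by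
        simpa using tendsto_inv_atTop_zero
      have := (h0.rpow_const (p := 1 - γ) (Or.inr hγ'.le)).mul_const (Real.Gamma (1 - γ))
      simpa [Real.zero_rpow hγ'.ne'] using this
    have h2 := ENNReal.Tendsto.const_mul (a := c) (ENNReal.tendsto_ofReal h1) (Or.inr hc)
    simpa using h2
  have hev := (hlim.eventually (ge_mem_nhds (by simp : (0 : ℝ≥0∞) < 2⁻¹))).and (eventually_gt_atTop 0)
  obtain ⟨l, hl, hl0⟩ := hev.exists
  exact ⟨l, hl0, by rwa [hval l hl0]⟩

/-- The exponent of the time singularity of the Oseen kernel in `L^{p'}`. -/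
noncomputable def oseenExponent (d : ℕ) (p : ℝ≥0∞) : ℝ := 1 / 2 + d / 2 * (p⁻¹).toReal

theorem toReal_inv_lt {d : ℕ} (hd : 0 < d) {p : ℝ≥0∞} (hp : (d : ℝ≥0∞) < p) :
    (p⁻¹).toReal < (d : ℝ)⁻¹ := by
  have h : p⁻¹ < (d : ℝ≥0∞)⁻¹ := ENNReal.inv_lt_inv.2 hp
  have h2 := (ENNReal.toReal_lt_toReal (h.ne_top) (by simp; omega)).2 h
  simpa [ENNReal.toReal_inv] using h2

/-- This is where `p > d` makes the time singularity integrable: `d/(2p) < 1/2`. -/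
theorem oseenExponent_lt_one {d : ℕ} (hd : 0 < d) {p : ℝ≥0∞} (hp : (d : ℝ≥0∞) < p) :
    oseenExponent d p < 1 := by
  have h := toReal_inv_lt hd hp
  have hd' : (0 : ℝ) < d := by exact_mod_cast hd
  have h2 : (d : ℝ) / 2 * (p⁻¹).toReal < d / 2 * (d : ℝ)⁻¹ := by gcongr
  have h3 : (d : ℝ) / 2 * (d : ℝ)⁻¹ = 1 / 2 := by field_simp
  unfold oseenExponent
  linarith

@[fun_prop]
theorem Measurable.oseenMajorant {d : ℕ} {β : Type*} [MeasurableSpace β] {f : β → ℝ} {g : β → Vec d}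
    (hf : Measurable f) (hg : Measurable g) : Measurable fun b => oseenMajorant (f b) (g b) := by
  have h := measurable_oseenMajorant.comp (hf.prodMk hg)
  exact h

theorem Measurable.uncurry_apply {α β δ γ : Type*} [MeasurableSpace α] [MeasurableSpace β]
    [MeasurableSpace γ] [MeasurableSpace δ] {U : α → β → γ} (hU : Measurable (Function.uncurry U))
    {f : δ → α} {g : δ → β} (hf : Measurable f) (hg : Measurable g) :
    Measurable fun b => U (f b) (g b) := by
  have h := hU.comp (hf.prodMk hg)
  exact h

theorem measurable_oseenMajorant_sub {d : ℕ} (τ : ℝ) :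
    Measurable (Function.uncurry fun x y : Vec d => oseenMajorant τ (x - y)) := by
  unfold Function.uncurry
  fun_prop

/-- The adjoint of `F ↦ K_τ * (U F)`, with `K_τ` the majorant of the Oseen kernel, is bounded on
`L^a` for `1 ≤ a ≤ p`. -/
theorem lintegral_mul_oseenMajorant_rpow_le {d : ℕ} {p : ℝ≥0∞} (hp1 : 1 ≤ p) {a : ℝ} (ha : 1 ≤ a)
    (hap : ENNReal.ofReal a ≤ p) {τ : ℝ} (hτ : 0 < τ) {U ψ : Vec d → ℝ≥0∞} (hU : Measurable U)
    (hψ : Measurable ψ) {M : ℝ≥0∞} (hM : eLpNorm U p volume ≤ M) :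
    ∫⁻ y, (U y * ∫⁻ x, oseenMajorant τ (x - y) * ψ x) ^ a ≤
      (M * oseenConst d * ENNReal.ofReal (τ ^ (-oseenExponent d p))) ^ a * ∫⁻ x, ψ x ^ a := by
  have hθ0 : 0 ≤ (p⁻¹).toReal := ENNReal.toReal_nonneg
  have hθ1 : (p⁻¹).toReal ≤ 1 := by
    rw [← ENNReal.toReal_one]
    exact ENNReal.toReal_mono (by simp) (by simpa using hp1)
  have h := lintegral_mul_kernel_rpow_le (μ := volume) (measurable_oseenMajorant_sub τ) hU hψ
    (K := oseenConst d * ENNReal.ofReal (τ ^ (-(1 : ℝ) / 2)))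
    (L := oseenConst d * ENNReal.ofReal (τ ^ (-(1 : ℝ) / 2)) * ENNReal.ofReal (τ ^ (-(d : ℝ) / 2)))
    (fun y => by
      rw [lintegral_sub_right_eq_self (oseenMajorant τ) y]
      exact lintegral_oseenMajorant_le hτ)
    (fun x => by
      rw [lintegral_sub_left_eq_self (oseenMajorant τ) x]
      exact lintegral_oseenMajorant_le hτ)
    (fun x y => oseenMajorant_le hτ _) ha hap
  refine h.trans ?_
  gcongr ?_ ^ a * _
  rw [mul_assoc, mul_assoc M]
  refine mul_le_mul' hM (le_of_eq ?_)
  rw [ENNReal.mul_rpow_of_nonneg _ (ENNReal.ofReal (τ ^ (-(d : ℝ) / 2))) hθ0, ← mul_assoc,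
    ← ENNReal.rpow_add_of_nonneg _ _ (by linarith) hθ0, sub_add_cancel, ENNReal.rpow_one, mul_assoc,
    ENNReal.ofReal_rpow_of_nonneg (by positivity) hθ0, ← Real.rpow_mul hτ.le,
    ← ENNReal.ofReal_mul (by positivity), ← Real.rpow_add hτ]
  congr 3
  unfold oseenExponent
  ring

/-! ### Gronwall's argument in the dual norm -/

section Volterra

variable {d : ℕ} {p : ℝ≥0∞} {t₀ : ℝ} {U g : ℝ → Vec d → ℝ≥0∞}

theorem measurable_duhamel (hU : Measurable (Function.uncurry U)) (t : ℝ) :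
    Measurable fun q : Vec d × ℝ =>
      ∫⁻ y, oseenMajorant (t - q.2) (q.1 - y) * U q.2 y ^ (2 : ℝ) := by
  have hU' : Measurable fun q : (Vec d × ℝ) × Vec d => U q.1.2 q.2 :=
    hU.uncurry_apply (by fun_prop) (by fun_prop)
  have hg : Measurable fun q : (Vec d × ℝ) × Vec d =>
      oseenMajorant (t - q.1.2) (q.1.1 - q.2) * U q.1.2 q.2 ^ (2 : ℝ) := by
    fun_prop
  have h := hg.lintegral_prod_right' (ν := volume)
  exact h

/-- Tonelli's theorem for the pairing of the Duhamel term with a test function. -/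
theorem lintegral_mul_duhamel_eq (hU : Measurable (Function.uncurry U)) {ψ : Vec d → ℝ≥0∞}
    (hψ : Measurable ψ) (t : ℝ) :
    ∫⁻ x, ψ x * ∫⁻ s in Set.Ioo 0 t, ∫⁻ y, oseenMajorant (t - s) (x - y) * U s y ^ (2 : ℝ) =
      ∫⁻ s in Set.Ioo 0 t, ∫⁻ y, (U s y * ∫⁻ x, oseenMajorant (t - s) (x - y) * ψ x) * U s y := by
  have hk : Measurable fun q : (Vec d × ℝ) × Vec d => oseenMajorant (t - q.1.2) (q.1.1 - q.2) := by
    fun_prop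
  have hU' : Measurable fun q : (Vec d × ℝ) × Vec d => U q.1.2 q.2 :=
    hU.uncurry_apply (by fun_prop) (by fun_prop)
  have hf : Measurable fun q : (Vec d × ℝ) × Vec d =>
      ψ q.1.1 * (oseenMajorant (t - q.1.2) (q.1.1 - q.2) * U q.1.2 q.2 ^ (2 : ℝ)) := by
    fun_prop
  have hg : Measurable fun q : (Vec d × ℝ) × Vec d =>
      oseenMajorant (t - q.1.2) (q.1.1 - q.2) * U q.1.2 q.2 ^ (2 : ℝ) := by
    fun_prop
  have hfi : Measurable fun q : Vec d × ℝ =>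
      ∫⁻ y, ψ q.1 * (oseenMajorant (t - q.2) (q.1 - y) * U q.2 y ^ (2 : ℝ)) := by
    have h := hf.lintegral_prod_right' (ν := volume)
    exact h
  have e1 : ∀ x, ψ x * ∫⁻ s in Set.Ioo 0 t, ∫⁻ y, oseenMajorant (t - s) (x - y) * U s y ^ (2 : ℝ) =
      ∫⁻ s in Set.Ioo 0 t, ∫⁻ y, ψ x * (oseenMajorant (t - s) (x - y) * U s y ^ (2 : ℝ)) := by
    intro x
    have h1 : Measurable fun s => ∫⁻ y, oseenMajorant (t - s) (x - y) * U s y ^ (2 : ℝ)  := by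
      have h := (measurable_duhamel hU t).comp (measurable_prodMk_left (x := x))
      exact h
    rw [← lintegral_const_mul _ h1]
    refine lintegral_congr fun s => ?_
    have h2 : Measurable fun y => oseenMajorant (t - s) (x - y) * U s y ^ (2 : ℝ) := by
      have h := hg.comp (measurable_prodMk_left (x := (x, s)))
      exact h
    rw [← lintegral_const_mul _ h2]
  simp_rw [e1]
  rw [lintegral_lintegral_swap hfi.aemeasurable]
  refine lintegral_congr fun s => ?_
  have h3 : Measurable fun q : Vec d × Vec d => ((q.1, s), q.2) := by fun_prop
  have hfs : Measurable (Function.uncurry fun x y =>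
      ψ x * (oseenMajorant (t - s) (x - y) * U s y ^ (2 : ℝ))) := by
    have h := hf.comp h3
    exact h
  rw [lintegral_lintegral_swap hfs.aemeasurable]
  refine lintegral_congr fun y => ?_
  have h4 : Measurable fun x => oseenMajorant (t - s) (x - y) * ψ x := by
    fun_prop
  rw [mul_comm (U s y), mul_assoc, ← lintegral_mul_const _ h4]
  refine lintegral_congr fun x => ?_
  rw [ENNReal.rpow_two, sq]
  ring

/-- Homogeneity: both constraints scale by the same `B`, so `B⁻¹ ψ` is an admissible test function.
-/
theorem lintegral_pairing_le_mul {a : ℝ} (ha : 0 ≤ a) {V : Vec d → ℝ≥0∞} {B N R : ℝ≥0∞} (hB0 : B ≠ 0)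
    (hBt : B ≠ ⊤)
    (hN : ∀ ψ : Vec d → ℝ≥0∞, Measurable ψ → ∫⁻ x, ψ x ^ (2 : ℝ) ≤ 1 → ∫⁻ x, ψ x ^ a ≤ R →
      ∫⁻ x, ψ x * V x ≤ N)
    {ψ : Vec d → ℝ≥0∞} (hψ : Measurable ψ) (h2 : ∫⁻ x, ψ x ^ (2 : ℝ) ≤ B ^ (2 : ℝ))
    (ha' : ∫⁻ x, ψ x ^ a ≤ B ^ a * R) :
    ∫⁻ x, ψ x * V x ≤ B * N := by
  have hscale : ∀ r : ℝ, 0 ≤ r → ∀ X, ∫⁻ x, ψ x ^ r ≤ B ^ r * X →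
      ∫⁻ x, (B⁻¹ * ψ x) ^ r ≤ X := by
    intro r hr X hX
    simp_rw [ENNReal.mul_rpow_of_nonneg _ _ hr]
    rw [lintegral_const_mul _ (hψ.pow_const r), ENNReal.inv_rpow]
    calc _ ≤ (B ^ r)⁻¹ * (B ^ r * X) := by gcongr
      _ = X := by
        rw [← mul_assoc, ENNReal.inv_mul_cancel, one_mul]
        · exact (ENNReal.rpow_pos (pos_iff_ne_zero.2 hB0) hBt).ne'
        · exact ENNReal.rpow_ne_top_of_nonneg hr hBt
  have h := hN (fun x => B⁻¹ * ψ x) (hψ.const_mul _) (hscale 2 (by norm_num) 1 (by simpa using h2))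
    (hscale a ha R ha')
  calc ∫⁻ x, ψ x * V x = ∫⁻ x, B * (B⁻¹ * ψ x * V x) := by
        refine lintegral_congr fun x => ?_
        rw [← mul_assoc, ← mul_assoc, ENNReal.mul_inv_cancel hB0 hBt, one_mul]
    _ = B * ∫⁻ x, B⁻¹ * ψ x * V x := lintegral_const_mul' _ _ hBt
    _ ≤ B * N := by gcongr

/-- A weighted Gronwall argument in the dual norm of `L^2 ∩ L^{p'}`: a solution of the integral
inequality that is bounded in `L^p` and has data in `L^2` is in `L^2`. -/
theorem lintegral_sq_ne_top_of_duhamel_le (hd : 2 ≤ d) (hp : (d : ℝ≥0∞) < p)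
    (ht₀ : 0 < t₀) (hU : Measurable (Function.uncurry U)) {M : ℝ≥0∞} (hMt : M ≠ ⊤)
    (hM : ∀ s ∈ Set.Ioc 0 t₀, eLpNorm (U s) p volume ≤ M) (hfin : ∀ᵐ x, U t₀ x ≠ ⊤)
    {A c : ℝ≥0∞} (hA : A ≠ ⊤) (hc : c ≠ ⊤)
    (hg : ∀ t ∈ Set.Ioc 0 t₀, ∀ ψ : Vec d → ℝ≥0∞, Measurable ψ → ∫⁻ x, ψ x ^ (2 : ℝ) ≤ 1 →
      ∫⁻ x, ψ x * g t x ≤ A)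
    (hduh : ∀ t ∈ Set.Ioc 0 t₀, ∀ᵐ x, U t x ≤ g t x +
      c * ∫⁻ s in Set.Ioo 0 t, ∫⁻ y, oseenMajorant (t - s) (x - y) * U s y ^ (2 : ℝ)) :
    ∫⁻ x, U t₀ x ^ (2 : ℝ) ≠ ⊤ := by
  wlog hM0 : M ≠ 0 generalizing M
  -- A vanishing bound is replaced by 1, since the scaling factor `B` below has to be nonzero.
  · exact this (M := 1) (by simp) (fun s hs => (hM s hs).trans (by simp_all)) (by simp)
  have hUs : ∀ s, Measurable (U s) := fun s => hU.comp measurable_prodMk_left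
  have hp2 : (2 : ℝ≥0∞) ≤ p := le_trans (by exact_mod_cast hd) hp.le
  have hp1 : (1 : ℝ≥0∞) < p := lt_of_lt_of_le (by norm_num) hp2
  have hθ : (p⁻¹).toReal ≤ 1 / 2 := by
    have h1 := ENNReal.toReal_mono (by simp) (ENNReal.inv_le_inv.2 hp2)
    simpa using h1
  set a : ℝ := (1 - (p⁻¹).toReal)⁻¹ with ha
  have hθ0 : 0 ≤ (p⁻¹).toReal := ENNReal.toReal_nonneg
  have ha1 : 1 ≤ a := (one_le_inv₀ (by linarith)).2 (by linarith)
  have ha2 : a ≤ 2 := by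
    rw [ha, inv_le_comm₀ (by linarith) (by norm_num)]
    linarith
  have hap : ENNReal.ofReal a ≤ p := by
    refine le_trans ?_ hp2
    rw [← ENNReal.ofReal_ofNat]
    exact ENNReal.ofReal_le_ofReal ha2
  -- The weight `e^{-ls}` is chosen so that the whole Duhamel operator has norm at most 1/2.
  obtain ⟨l, hl, hlam⟩ := exists_lintegral_rpow_mul_exp_le
    (oseenExponent_lt_one (by omega) hp) (c := c * (M * oseenConst d))
    (ENNReal.mul_ne_top hc (ENNReal.mul_ne_top hMt (oseenConst_ne_top d)))
  set γ := oseenExponent d p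
  have key : ∀ R : ℝ≥0∞, R ≠ ⊤ → ∀ ψ : Vec d → ℝ≥0∞, Measurable ψ → ∫⁻ x, ψ x ^ (2 : ℝ) ≤ 1 →
      ∫⁻ x, ψ x ^ a ≤ R → ∫⁻ x, ψ x * U t₀ x ≤ ENNReal.ofReal (Real.exp (l * t₀)) * (2 * A) := by
    intro R hR
    set S : Set (Vec d → ℝ≥0∞) :=
      {ψ | Measurable ψ ∧ ∫⁻ x, ψ x ^ (2 : ℝ) ≤ 1 ∧ ∫⁻ x, ψ x ^ a ≤ R} with hS
    set Φ : ℝ≥0∞ := ⨆ s ∈ Set.Ioc 0 t₀, ⨆ ψ ∈ S,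
      ENNReal.ofReal (Real.exp (-(l * s))) * ∫⁻ x, ψ x * U s x with hΦ
    have hΦle : ∀ s ∈ Set.Ioc 0 t₀, ∀ ψ ∈ S,
        ENNReal.ofReal (Real.exp (-(l * s))) * ∫⁻ x, ψ x * U s x ≤ Φ := fun s hs ψ hψ =>
      le_iSup₂_of_le s hs (le_iSup₂_of_le ψ hψ le_rfl)
    have hΦle' : ∀ s ∈ Set.Ioc 0 t₀, ∀ ψ ∈ S,
        ∫⁻ x, ψ x * U s x ≤ ENNReal.ofReal (Real.exp (l * s)) * Φ := by
      intro s hs ψ hψ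
      calc _ = ENNReal.ofReal (Real.exp (l * s)) *
            (ENNReal.ofReal (Real.exp (-(l * s))) * ∫⁻ x, ψ x * U s x) := by
            rw [← mul_assoc, ← ENNReal.ofReal_mul (Real.exp_pos _).le, ← Real.exp_add]
            simp
        _ ≤ _ := by
            gcongr
            exact hΦle s hs ψ hψ
    -- The constraint `∫ ψ^a ≤ R` serves to make `Φ` finite, which allows the absorption below; the
    -- final bound `2A` is free of `R`.
    have hΦt : Φ ≠ ⊤ := by
      have hb : Φ ≤ R ^ (1 - (p⁻¹).toReal) * M := by
        refine iSup₂_le fun s hs => iSup₂_le fun ψ hψ => ?_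
        calc _ ≤ 1 * ∫⁻ x, ψ x * U s x := by
              gcongr
              rw [ENNReal.ofReal_le_one, Real.exp_le_one_iff]
              have := hs.1
              nlinarith
          _ ≤ _ := by
              rw [one_mul]
              refine (lintegral_mul_le_eLpNorm hψ.1 (hUs s) hp1).trans ?_
              have h1 : 0 ≤ 1 - (p⁻¹).toReal := by linarith
              gcongr
              · exact hψ.2.2
              · exact hM s hs
      exact (hb.trans_lt (ENNReal.mul_lt_top (ENNReal.rpow_lt_top_of_nonneg (by linarith) hR)
        hMt.lt_top)).ne
    have hstep : Φ ≤ A + 2⁻¹ * Φ := by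
      refine iSup₂_le fun t ht => iSup₂_le fun ψ hψ => ?_
      have hpair : ∫⁻ x, ψ x * U t x ≤ A + c * ∫⁻ s in Set.Ioo 0 t, ∫⁻ y,
          (U s y * ∫⁻ x, oseenMajorant (t - s) (x - y) * ψ x) * U s y := by
        have hD : Measurable fun x => ∫⁻ s in Set.Ioo 0 t, ∫⁻ y,
            oseenMajorant (t - s) (x - y) * U s y ^ (2 : ℝ) :=
          (measurable_duhamel hU t).lintegral_prod_right'
        have hψm := hψ.1
        rw [← lintegral_mul_duhamel_eq hU hψm t, ← lintegral_const_mul' _ _ hc]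
        calc ∫⁻ x, ψ x * U t x ≤ ∫⁻ x, (ψ x * g t x + c * (ψ x * ∫⁻ s in Set.Ioo 0 t, ∫⁻ y,
              oseenMajorant (t - s) (x - y) * U s y ^ (2 : ℝ))) := by
              refine lintegral_mono_ae ?_
              filter_upwards [hduh t ht] with x hx
              calc _ ≤ ψ x * _ := mul_le_mul_right hx _
                _ = _ := by ring
          _ = (∫⁻ x, ψ x * g t x) + ∫⁻ x, c * (ψ x * ∫⁻ s in Set.Ioo 0 t, ∫⁻ y,
              oseenMajorant (t - s) (x - y) * U s y ^ (2 : ℝ)) :=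
              lintegral_add_right _ (by fun_prop)
          _ ≤ _ := by
              gcongr
              exact hg t ht ψ hψm hψ.2.1
      -- The adjoint image of `ψ` is `B` times an admissible test function, `B` being the common
      -- operator norm on `L^2` and `L^a`. Its pairing with `U s` is therefore again controlled by
      -- `Φ`.
      have hinner : ∀ s ∈ Set.Ioo 0 t, ∫⁻ y,
          (U s y * ∫⁻ x, oseenMajorant (t - s) (x - y) * ψ x) * U s y ≤
          M * oseenConst d * ENNReal.ofReal ((t - s) ^ (-γ)) *
            (ENNReal.ofReal (Real.exp (l * s)) * Φ) := by
        intro s hs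
        have hs' : s ∈ Set.Ioc 0 t₀ := ⟨hs.1, hs.2.le.trans ht.2⟩
        have hτ : 0 < t - s := sub_pos.2 hs.2
        have hpos : (0 : ℝ) < (t - s) ^ (-γ) := Real.rpow_pos_of_pos hτ _
        have hm : Measurable fun y => U s y * ∫⁻ x, oseenMajorant (t - s) (x - y) * ψ x := by
          refine (hUs s).mul ?_
          exact (((measurable_oseenMajorant_sub (t - s)).comp measurable_swap).mul
            (hψ.1.comp measurable_snd)).lintegral_prod_right'
        refine lintegral_pairing_le_mul (a := a) (R := R) (by linarith) ?_ ?_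
          (fun ψ' h1 h2 h3 => hΦle' s hs' ψ' ⟨h1, h2, h3⟩) hm ?_ ?_
        · have : oseenConst d ≠ 0 := by unfold oseenConst; simp; positivity
          simp [hM0, this, hpos]
        · exact ENNReal.mul_ne_top (ENNReal.mul_ne_top hMt (oseenConst_ne_top d))
            ENNReal.ofReal_ne_top
        · refine (lintegral_mul_oseenMajorant_rpow_le hp1.le (by norm_num) (by simpa using hp2) hτ
            (hUs s) hψ.1 (hM s hs')).trans ?_
          calc _ ≤ (M * oseenConst d * ENNReal.ofReal ((t - s) ^ (-γ))) ^ (2 : ℝ) * 1 := by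
                gcongr
                exact hψ.2.1
            _ = _ := mul_one _
        · refine (lintegral_mul_oseenMajorant_rpow_le hp1.le ha1 hap hτ
            (hUs s) hψ.1 (hM s hs')).trans ?_
          gcongr
          exact hψ.2.2
      -- Substituting `τ = t - s` turns the weighted time integral into part of the Laplace
      -- transform of `τ^{-γ}`.
      have htime : ENNReal.ofReal (Real.exp (-(l * t))) *
          ∫⁻ s in Set.Ioo 0 t, ENNReal.ofReal ((t - s) ^ (-γ)) * ENNReal.ofReal (Real.exp (l * s)) ≤
          ∫⁻ τ in Set.Ioi (0 : ℝ), ENNReal.ofReal (τ ^ (-γ) * Real.exp (-(l * τ))) := by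
        set F : ℝ → ℝ≥0∞ := (Set.Ioi (0 : ℝ)).indicator fun τ =>
          ENNReal.ofReal (τ ^ (-γ) * Real.exp (-(l * τ))) with hF
        calc _ = ∫⁻ s in Set.Ioo 0 t, F (t - s) := by
              rw [← lintegral_const_mul' _ _ ENNReal.ofReal_ne_top]
              refine setLIntegral_congr_fun measurableSet_Ioo fun s hs => ?_
              have hτ : 0 < t - s := sub_pos.2 hs.2
              simp only [hF, Set.indicator_of_mem (Set.mem_Ioi.2 hτ)]
              rw [← ENNReal.ofReal_mul (by positivity), ← ENNReal.ofReal_mul (by positivity),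
                mul_left_comm, ← Real.exp_add]
              congr 3
              ring
          _ ≤ ∫⁻ s, F (t - s) := setLIntegral_le_lintegral _ _
          _ = ∫⁻ s, F s := lintegral_sub_left_eq_self F t
          _ = _ := lintegral_indicator measurableSet_Ioi _
      calc _ ≤ ENNReal.ofReal (Real.exp (-(l * t))) * (A + c * ∫⁻ s in Set.Ioo 0 t,
            (M * oseenConst d * Φ) * (ENNReal.ofReal ((t - s) ^ (-γ)) *
              ENNReal.ofReal (Real.exp (l * s)))) := by
            gcongr
            refine hpair.trans ?_
            gcongr 2
            refine setLIntegral_mono' measurableSet_Ioo fun s hs => (hinner s hs).trans_eq ?_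
            ring
        _ = ENNReal.ofReal (Real.exp (-(l * t))) * A + c * (M * oseenConst d) *
            (ENNReal.ofReal (Real.exp (-(l * t))) * ∫⁻ s in Set.Ioo 0 t,
              ENNReal.ofReal ((t - s) ^ (-γ)) * ENNReal.ofReal (Real.exp (l * s))) * Φ := by
            rw [lintegral_const_mul' _ _ (ENNReal.mul_ne_top
              (ENNReal.mul_ne_top hMt (oseenConst_ne_top d)) hΦt)]
            ring
        _ ≤ 1 * A + 2⁻¹ * Φ := by
            gcongr
            · rw [ENNReal.ofReal_le_one, Real.exp_le_one_iff]
              have := ht.1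
              nlinarith
            · refine le_trans ?_ hlam
              gcongr
        _ = _ := by rw [one_mul]
    have hΦA : Φ ≤ 2 * A := by
      have h1 : 2⁻¹ * Φ + 2⁻¹ * Φ ≤ A + 2⁻¹ * Φ := by
        rwa [← add_mul, ENNReal.inv_two_add_inv_two, one_mul]
      have h2 : 2⁻¹ * Φ ≤ A :=
        (ENNReal.add_le_add_iff_right (ENNReal.mul_ne_top (by simp) hΦt)).1 h1
      calc Φ = 2 * (2⁻¹ * Φ) := by
            rw [← mul_assoc, ENNReal.mul_inv_cancel (by simp) (by simp), one_mul]
        _ ≤ _ := by gcongr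
    intro ψ hψ h2 h3
    refine (hΦle' t₀ ⟨ht₀, le_rfl⟩ ψ ⟨hψ, h2, h3⟩).trans ?_
    gcongr
  have hfinal := lintegral_sq_le_of_pairing_le (μ := volume) (a := a)
    (fun x r => (isCompact_closedBall x r).measure_lt_top.ne) (hUs t₀) hfin
    (by linarith) fun ψ hψ h2 h3 => key _ h3 ψ hψ h2 le_rfl
  refine (hfinal.trans_lt (ENNReal.rpow_lt_top_of_nonneg (by norm_num) ?_)).ne
  exact ENNReal.mul_ne_top ENNReal.ofReal_ne_top (ENNReal.mul_ne_top (by simp) hA)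

end Volterra

/-! ### Persistence of `L^2` for strong solutions -/

theorem enorm_toLp_le_sum {d : ℕ} (f : Fin d → ℝ) : ‖(WithLp.toLp 2 f : Vec d)‖ₑ ≤ ∑ i, ‖f i‖ₑ := by
  have h : (WithLp.toLp 2 f : Vec d) = ∑ i, EuclideanSpace.single i (f i) := by
    ext j
    simp [Finset.sum_apply, Pi.single_apply]
  rw [h]
  refine (enorm_sum_le _ _).trans (Finset.sum_le_sum fun i _ => ?_)
  rw [← ofReal_norm, ← ofReal_norm, PiLp.norm_single]

/-- The factor `d^3` counts the triples `(i, j, k)`, each of which obeys the same bound because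
`|v_j v_k| ≤ |v|²`. -/
theorem enorm_oseenFlow_le {d : ℕ} {τ : ℝ} (hτ : 0 < τ) (v : Vec d → Vec d) (x : Vec d) :
    ‖oseenFlow τ (fun y j k => v y j * v y k) x‖ₑ ≤
      (d : ℝ≥0∞) ^ 3 * ∫⁻ y, oseenMajorant τ (x - y) * ‖v y‖ₑ ^ (2 : ℝ) := by
  have hcoord : ∀ (w : Vec d) (j : Fin d), ‖w j‖ₑ ≤ ‖w‖ₑ := fun w j => by
    rw [← ofReal_norm, ← ofReal_norm]
    exact ENNReal.ofReal_le_ofReal (PiLp.norm_apply_le w j)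
  have hterm : ∀ i j k : Fin d, ‖∫ y, oseenKernel i j k τ (x - y) * (v y j * v y k)‖ₑ ≤
      ∫⁻ y, oseenMajorant τ (x - y) * ‖v y‖ₑ ^ (2 : ℝ) := by
    intro i j k
    refine (enorm_integral_le_lintegral_enorm _).trans (lintegral_mono fun y => ?_)
    rw [enorm_mul, enorm_mul, ENNReal.rpow_two, sq]
    gcongr
    · exact enorm_oseenKernel_le i j k hτ _
    · exact hcoord _ _
    · exact hcoord _ _
  unfold oseenFlow
  refine (enorm_toLp_le_sum _).trans ?_
  calc _ ≤ ∑ _i : Fin d, ∑ _j : Fin d, ∑ _k : Fin d,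
        ∫⁻ y, oseenMajorant τ (x - y) * ‖v y‖ₑ ^ (2 : ℝ) := by
        refine Finset.sum_le_sum fun i _ => (enorm_sum_le _ _).trans ?_
        refine Finset.sum_le_sum fun j _ => (enorm_sum_le _ _).trans ?_
        exact Finset.sum_le_sum fun k _ => hterm i j k
    _ = _ := by
        simp only [Finset.sum_const, Finset.card_univ, Fintype.card_fin, nsmul_eq_mul]
        ring

/-- The heat semigroup is a contraction on `L^2`, paired with a normalised test function. -/
theorem lintegral_mul_heat_le {d : ℕ} {t : ℝ} (ht : 0 < t) {ψ v : Vec d → ℝ≥0∞}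
    (hψ : Measurable ψ) (hψ2 : ∫⁻ x, ψ x ^ (2 : ℝ) ≤ 1) (hv : Measurable v) :
    ∫⁻ x, ψ x * ∫⁻ y, ENNReal.ofReal (heatKernel t (x - y)) * v y ≤
      (∫⁻ y, v y ^ (2 : ℝ)) ^ (1 / 2 : ℝ) := by
  have hk : Measurable (Function.uncurry fun y x : Vec d =>
      ENNReal.ofReal (heatKernel t (x - y))) := by
    unfold Function.uncurry heatKernel
    fun_prop
  set g : Vec d → ℝ≥0∞ := fun x => ∫⁻ y, ENNReal.ofReal (heatKernel t (x - y)) * v y with hg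
  have hgm : Measurable g :=
    ((hk.comp measurable_swap).mul (hv.comp measurable_snd)).lintegral_prod_right'
  have h1 : ∫⁻ x, g x ^ (2 : ℝ) ≤ ∫⁻ y, v y ^ (2 : ℝ) := by
    -- For `p = ⊤` the supremum of the kernel enters with exponent 0, so `L = ⊤` is harmless.
    have h := lintegral_mul_kernel_rpow_le (μ := volume) hk (U := fun _ => 1) measurable_const hv
      (K := 1) (L := ⊤) (fun y => by
        rw [lintegral_sub_left_eq_self (fun z => ENNReal.ofReal (heatKernel t z)) y]
        exact (lintegral_heatKernel ht).le) (fun x => by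
        rw [lintegral_sub_right_eq_self (fun z => ENNReal.ofReal (heatKernel t z)) x]
        exact (lintegral_heatKernel ht).le) (fun _ _ => le_top) (p := ⊤) (a := 2)
        (by norm_num) le_top
    have h1' : eLpNorm (fun _ : Vec d => (1 : ℝ≥0∞)) ⊤ volume ≤ 1 := by
      rw [eLpNorm_exponent_top]
      refine eLpNormEssSup_le_of_ae_enorm_bound (ae_of_all _ fun _ => ?_)
      simp
    simp only [one_mul] at h
    refine h.trans ?_
    calc _ ≤ (1 * 1 * 1 : ℝ≥0∞) ^ (2 : ℝ) * ∫⁻ y, v y ^ (2 : ℝ) := by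
          gcongr
          · simp
          · simp
      _ = _ := by simp
  have h2 := lintegral_mul_le_eLpNorm (μ := volume) hψ hgm (p := 2) (by norm_num)
  refine h2.trans ?_
  have e : (1 - ((2 : ℝ≥0∞)⁻¹).toReal)⁻¹ = 2 := by
    rw [ENNReal.toReal_inv]; norm_num
  rw [e, eLpNorm_eq_lintegral_rpow_enorm_toReal (by simp) (by simp)]
  simp only [enorm_eq_self, ENNReal.toReal_ofNat]
  calc _ ≤ (1 : ℝ≥0∞) ^ (1 - ((2 : ℝ≥0∞)⁻¹).toReal) * (∫⁻ y, v y ^ (2 : ℝ)) ^ (1 / 2 : ℝ) := by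
        have h0 : 0 ≤ 1 - ((2 : ℝ≥0∞)⁻¹).toReal := by
          rw [ENNReal.toReal_inv]; norm_num
        gcongr
    _ = _ := by simp

/-- A strong solution in `L^p` with data in `L^2` remains in `L^2`. -/
theorem IsStrongSolution.memLp_two {d : ℕ} (hd : 2 ≤ d) {p T : ℝ≥0∞} (hp : (d : ℝ≥0∞) < p)
    {u₀ : Vec d → Vec d} {u : ℝ → Vec d → Vec d} (hu₀ : MemLp u₀ 2 volume)
    (hu : IsStrongSolution p T u₀ u) {t : ℝ} (ht : 0 < t) (htT : ENNReal.ofReal t < T) :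
    MemLp (u t) 2 volume := by
  have hp1 : (1 : ℝ≥0∞) ≤ p := le_trans (by exact_mod_cast (by omega : 1 ≤ d)) hp.le
  have hIm : MeasurableSet {s : ℝ | 0 < s ∧ ENNReal.ofReal s < T} :=
    measurableSet_Ioi.inter (measurableSet_lt ENNReal.measurable_ofReal measurable_const)
  obtain ⟨U, hUm, hUe⟩ := exists_measurable_enorm_version (μ := volume) hp1 hIm (u := u)
    (fun s hs => hu.memLp s hs.1 hs.2) (fun s hs => hu.continuous s hs.1 hs.2)
  have hI : ∀ s ∈ Set.Ioc 0 t, 0 < s ∧ ENNReal.ofReal s < T := fun s hs =>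
    ⟨hs.1, (ENNReal.ofReal_le_ofReal hs.2).trans_lt htT⟩
  obtain ⟨M, hM⟩ := hu.bounded t ht htT
  obtain ⟨v, hvm, hve⟩ := hu₀.1
  have hUt := hUe t ⟨ht, htT⟩
  have hv2 : (∫⁻ y, ‖v y‖ₑ ^ (2 : ℝ)) ^ (1 / 2 : ℝ) ≠ ⊤ := by
    have h := hu₀.2
    rw [eLpNorm_congr_ae hve, eLpNorm_eq_lintegral_rpow_enorm_toReal (by simp) (by simp)] at h
    simpa using h.ne
  have hmain := lintegral_sq_ne_top_of_duhamel_le hd hp ht hUm (M := M) (by simp)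
    (fun s hs => by
      rw [eLpNorm_congr_enorm_ae (g := u s)]
      · exact hM s hs
      · filter_upwards [hUe s (hI s hs)] with x hx
        simpa using hx)
    (by
      filter_upwards [hUt] with x hx
      simp [hx])
    hv2 (c := (d : ℝ≥0∞) ^ 3) (by simp)
    (g := fun s x => ∫⁻ y, ENNReal.ofReal (heatKernel s (x - y)) * ‖v y‖ₑ)
    (fun s hs ψ hψ hψ2 => lintegral_mul_heat_le hs.1 hψ hψ2 hvm.enorm)
    (fun s hs => by
      filter_upwards [hUe s (hI s hs), hu.duhamel s hs.1 (hI s hs).2] with x hx hd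
      rw [hx, hd]
      refine (enorm_sub_le).trans (add_le_add ?_ ?_)
      · refine (enorm_integral_le_lintegral_enorm _).trans (le_of_eq ?_)
        refine lintegral_congr_ae ?_
        filter_upwards [hve] with y hy
        rw [enorm_smul, hy, Real.enorm_eq_ofReal (heatKernel_nonneg hs.1.le _)]
      · rw [intervalIntegral.integral_of_le hs.1.le, integral_Ioc_eq_integral_Ioo]
        refine (enorm_integral_le_lintegral_enorm _).trans ?_
        rw [← lintegral_const_mul' _ _ (by simp)]
        refine setLIntegral_mono' measurableSet_Ioo fun r hr => ?_
        refine (enorm_oseenFlow_le (sub_pos.2 hr.2) (u r) x).trans (le_of_eq ?_)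
        congr 1
        refine lintegral_congr_ae ?_
        filter_upwards [hUe r (hI r ⟨hr.1, hr.2.le.trans hs.2⟩)] with y hy
        rw [hy])
  refine ⟨(hu.memLp t ht htT).1, ?_⟩
  rw [eLpNorm_eq_lintegral_rpow_enorm_toReal (by simp) (by simp)]
  refine ENNReal.rpow_lt_top_of_nonneg (by simp) ?_
  convert hmain using 1
  refine lintegral_congr_ae ?_
  filter_upwards [hUt] with x hx
  rw [hx]
  simp

/-! ### Bernstein's inequality for dyadic blocks -/

/-- Bernstein's inequality for an abstract kernel: `L^2 → L^p` bounds for `2 ≤ p ≤ ∞`. -/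
theorem eLpNorm_kernel_le {α : Type*} [MeasurableSpace α] {μ : Measure α} [SFinite μ]
    {k : α → α → ℝ≥0∞} (hk : Measurable (Function.uncurry k))
    {v : α → ℝ≥0∞} (hv : Measurable v) {K L : ℝ≥0∞}
    (hK : ∀ y, ∫⁻ x, k x y ∂μ ≤ K) (hK' : ∀ x, ∫⁻ y, k x y ∂μ ≤ K) (hL : ∀ x y, k x y ≤ L)
    {p : ℝ≥0∞} (hp : 2 ≤ p) :
    eLpNorm (fun y => ∫⁻ x, k x y * v x ∂μ) p μ ≤
      K ^ (1 / 2 + (p⁻¹).toReal) * L ^ (1 / 2 - (p⁻¹).toReal) *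
        (∫⁻ x, v x ^ (2 : ℝ) ∂μ) ^ (1 / 2 : ℝ) := by
  set N := ∫⁻ x, v x ^ (2 : ℝ) ∂μ with hN
  have hv2 : Measurable fun x => v x ^ (2 : ℝ) := hv.pow_const _
  set h : α → ℝ≥0∞ := fun y => ∫⁻ x, k x y * v x ^ (2 : ℝ) ∂μ with hh
  set g : α → ℝ≥0∞ := fun y => ∫⁻ x, k x y * v x ∂μ with hg
  have hgh : ∀ y, g y ^ (2 : ℝ) ≤ K * h y := by
    intro y
    have h := lintegral_mul_rpow_le (μ := μ) (hk.comp (measurable_prodMk_right (y := y))) hv (hK y)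
      (a := 2) (by norm_num)
    norm_num at h
    simpa [hg, hh] using h
  have hh1 : ∫⁻ y, h y ∂μ ≤ K * N := lintegral_lintegral_kernel_le hk hv2 hK'
  have hh2 : ∀ y, h y ≤ L * N := by
    intro y
    rw [hN, ← lintegral_const_mul _ hv2]
    refine lintegral_mono fun x => ?_
    exact mul_le_mul_left (hL x y) _
  have hhm : Measurable h :=
    ((hk.comp measurable_swap).mul (hv2.comp measurable_snd)).lintegral_prod_right'
  have hsup : ∀ y, g y ^ (2 : ℝ) ≤ K * (L * N) := fun y => (hgh y).trans (by gcongr; exact hh2 y)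
  have hint : ∫⁻ y, g y ^ (2 : ℝ) ∂μ ≤ K * (K * N) := by
    refine (lintegral_mono hgh).trans ?_
    rw [lintegral_const_mul _ hhm]
    gcongr
  rcases eq_or_ne p ∞ with rfl | hpt
  · rw [eLpNorm_exponent_top]
    refine essSup_le_of_ae_le _ (ae_of_all _ fun y => ?_)
    simp only [enorm_eq_self, ENNReal.inv_top, ENNReal.toReal_zero, add_zero, sub_zero]
    calc g y = (g y ^ (2 : ℝ)) ^ (1 / 2 : ℝ) := by rw [← ENNReal.rpow_mul]; norm_num
      _ ≤ (K * (L * N)) ^ (1 / 2 : ℝ) := by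
          gcongr
          exact hsup y
      _ = _ := by
          rw [ENNReal.mul_rpow_of_nonneg _ _ (by norm_num),
            ENNReal.mul_rpow_of_nonneg _ _ (by norm_num)]
          ring
  · have hp0 : p ≠ 0 := (zero_lt_two.trans_le hp).ne'
    have hr : 2 ≤ p.toReal := by
      have := ENNReal.toReal_mono hpt hp
      simpa using this
    rw [ENNReal.toReal_inv, eLpNorm_eq_lintegral_rpow_enorm_toReal hp0 hpt]
    set r := p.toReal
    simp only [enorm_eq_self]
    -- Interpolation between `L^2` and `L^∞`: all but two powers of `g` are estimated by the
    -- supremum.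
    have hpt : ∀ y, g y ^ r ≤ (K * (L * N)) ^ (r / 2 - 1) * g y ^ (2 : ℝ) := by
      intro y
      calc g y ^ r = (g y ^ (2 : ℝ)) ^ (r / 2 - 1) * (g y ^ (2 : ℝ)) ^ (1 : ℝ) := by
            rw [← ENNReal.rpow_add_of_nonneg _ _ (by linarith) (by norm_num), ← ENNReal.rpow_mul]
            congr 1
            ring
        _ ≤ _ := by
            rw [ENNReal.rpow_one]
            gcongr
            · linarith
            · exact hsup y
    have hgm : Measurable g :=
      ((hk.comp measurable_swap).mul (hv.comp measurable_snd)).lintegral_prod_right'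
    have hr0 : 0 ≤ r / 2 - 1 := by linarith
    calc _ ≤ ((K * (L * N)) ^ (r / 2 - 1) * (K * (K * N))) ^ (1 / r) := by
          gcongr
          refine (lintegral_mono hpt).trans ?_
          rw [lintegral_const_mul _ (hgm.pow_const _)]
          gcongr
      _ = (K * (L * N)) ^ (1 / 2 - r⁻¹) * (K * (K * N)) ^ r⁻¹ := by
          rw [ENNReal.mul_rpow_of_nonneg _ _ (by positivity), ← ENNReal.rpow_mul, one_div]
          congr 2
          field_simp
      _ = _ := by
          have h0 : 0 ≤ 1 / 2 - r⁻¹ := by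
            have : r⁻¹ ≤ 2⁻¹ := inv_anti₀ (by norm_num) hr
            linarith
          have h1 : 0 ≤ r⁻¹ := by positivity
          rw [ENNReal.mul_rpow_of_nonneg _ _ h0, ENNReal.mul_rpow_of_nonneg _ _ h0,
            ENNReal.mul_rpow_of_nonneg _ _ h1, ENNReal.mul_rpow_of_nonneg _ _ h1,
            show (1 / 2 + r⁻¹ : ℝ) = (1 / 2 - r⁻¹) + r⁻¹ + r⁻¹ by ring,
            ENNReal.rpow_add_of_nonneg _ _ (by linarith) h1,
            ENNReal.rpow_add_of_nonneg _ _ h0 h1]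
          have e : N ^ (1 / 2 : ℝ) = N ^ (1 / 2 - r⁻¹) * N ^ r⁻¹ := by
            rw [← ENNReal.rpow_add_of_nonneg _ _ h0 h1]
            congr 1
            ring
          rw [e]
          ring

theorem IsLittlewoodPaley.exists_schwartzMap {d : ℕ} {φ : Vec d → ℝ} (hφ : IsLittlewoodPaley φ) :
    ∃ f : SchwartzMap (Vec d) ℂ, ∀ x, lpKernel φ x = (f x).re := by
  have hcs : HasCompactSupport fun ξ : Vec d => (φ ((2 * Real.pi) • ξ) : ℂ) := by
    refine HasCompactSupport.intro (isCompact_closedBall (0 : Vec d) (8 / 3)) fun ξ hξ => ?_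
    by_contra hne
    have hs := (hφ.support _ (by exact_mod_cast hne)).2
    rw [mem_closedBall_zero_iff, not_le] at hξ
    rw [norm_smul, Real.norm_of_nonneg (by positivity)] at hs
    nlinarith [Real.pi_gt_three, norm_nonneg ξ]
  have hsm : ContDiff ℝ ∞ fun ξ : Vec d => (φ ((2 * Real.pi) • ξ) : ℂ) :=
    Complex.ofRealCLM.contDiff.comp (hφ.smooth.comp (contDiff_const_smul _))
  refine ⟨𝓕⁻ (hcs.toSchwartzMap hsm), fun x => ?_⟩
  rw [SchwartzMap.fourierInv_coe]
  rfl

/-- The kernel is the real part of a Schwartz function, hence bounded and integrable. The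
normalisation `1 ≤ H` is used later to compare powers of `4H`. -/
theorem IsLittlewoodPaley.lpKernel_bounds {d : ℕ} {φ : Vec d → ℝ} (hφ : IsLittlewoodPaley φ) :
    Continuous (lpKernel φ) ∧ ∃ H : ℝ≥0, 1 ≤ H ∧ (∀ x, ‖lpKernel φ x‖ₑ ≤ H) ∧
      ∫⁻ x, ‖lpKernel φ x‖ₑ ≤ H := by
  obtain ⟨f, hf⟩ := hφ.exists_schwartzMap
  have hfe : lpKernel φ = fun x => (f x).re := funext hf
  have hcont : Continuous (lpKernel φ) := by
    rw [hfe]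
    exact Complex.continuous_re.comp f.continuous
  have hint : Integrable (lpKernel φ) := by
    rw [hfe]
    exact (f.integrable (μ := volume)).re
  set B := ‖f.toBoundedContinuousFunction‖
  refine ⟨hcont, max 1 (max B.toNNReal (∫⁻ x, ‖lpKernel φ x‖ₑ).toNNReal), le_max_left _ _, ?_, ?_⟩
  · intro x
    have h1 : ‖f x‖ ≤ B := f.toBoundedContinuousFunction.norm_coe_le_norm x
    have h2 : ‖lpKernel φ x‖ ≤ B := by
      rw [hf]
      exact (Complex.abs_re_le_norm _).trans h1
    calc ‖lpKernel φ x‖ₑ = ENNReal.ofReal ‖lpKernel φ x‖ := (ofReal_norm _).symm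
      _ ≤ (B.toNNReal : ℝ≥0∞) := ENNReal.ofReal_le_ofReal h2
      _ ≤ _ := by
        norm_cast
        exact (le_max_left _ _).trans (le_max_right _ _)
  · calc _ = ((∫⁻ x, ‖lpKernel φ x‖ₑ).toNNReal : ℝ≥0∞) :=
          (ENNReal.coe_toNNReal hint.2.ne).symm
      _ ≤ _ := by
        norm_cast
        exact (le_max_right _ _).trans (le_max_right _ _)

theorem lintegral_enorm_dilation {d : ℕ} {h : Vec d → ℝ} (hh : Measurable h) {r : ℝ} (hr : 0 < r) :
    ∫⁻ x, ‖r ^ d * h (r • x)‖ₑ = ∫⁻ x, ‖h x‖ₑ := by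
  have hm : Measurable fun x : Vec d => r • x := measurable_const_smul r
  have h1 : ∫⁻ x, ‖h (r • x)‖ₑ = ENNReal.ofReal (|(r ^ d)⁻¹|) * ∫⁻ x, ‖h x‖ₑ := by
    rw [← lintegral_map (f := fun x => ‖h x‖ₑ) (by fun_prop) hm,
      Measure.map_addHaar_smul volume hr.ne', lintegral_smul_measure, finrank_euclideanSpace_fin]
    rfl
  simp_rw [enorm_mul]
  rw [lintegral_const_mul _ (by fun_prop), h1, ← mul_assoc, Real.enorm_eq_ofReal_abs,
    ← ENNReal.ofReal_mul (abs_nonneg _), ← abs_mul, mul_inv_cancel₀ (by positivity)]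
  simp

section Dyadic

variable {d : ℕ} {φ : Vec d → ℝ} {f : Vec d → Vec d}

theorem aestronglyMeasurable_dyadicBlock (hφ : Continuous (lpKernel φ))
    (hf : AEStronglyMeasurable f volume) (j : ℤ) :
    AEStronglyMeasurable (dyadicBlock φ j f) volume := by
  obtain ⟨v, hv, hfv⟩ := hf
  have e : dyadicBlock φ j f = fun x =>
      ∫ y, (((2 : ℝ) ^ j) ^ d * lpKernel φ ((2 : ℝ) ^ j • (x - y))) • v y := by
    ext1 x
    refine integral_congr_ae ?_
    filter_upwards [hfv] with y hy
    rw [hy]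
  rw [e]
  have hk : StronglyMeasurable fun q : Vec d × Vec d =>
      ((2 : ℝ) ^ j) ^ d * lpKernel φ ((2 : ℝ) ^ j • (q.1 - q.2)) :=
    (by fun_prop : Continuous _).stronglyMeasurable
  have h := (hk.smul (hv.comp_measurable measurable_snd)).integral_prod_right' (ν := volume)
  exact h.aestronglyMeasurable

/-- Bernstein's inequality for a dyadic block. -/
theorem eLpNorm_dyadicBlock_le (hφ : Continuous (lpKernel φ)) {H : ℝ≥0}
    (hH : ∀ x, ‖lpKernel φ x‖ₑ ≤ H) (hH1 : ∫⁻ x, ‖lpKernel φ x‖ₑ ≤ H)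
    (hf : AEStronglyMeasurable f volume) {p : ℝ≥0∞} (hp : 2 ≤ p) (j : ℤ) :
    eLpNorm (dyadicBlock φ j f) p volume ≤
      H * ENNReal.ofReal ((2 : ℝ) ^ ((d : ℝ) * (1 / 2 - (p⁻¹).toReal) * j)) *
        eLpNorm f 2 volume := by
  have hθ : (p⁻¹).toReal ≤ 1 / 2 := by
    have h1 := ENNReal.toReal_mono (by simp) (ENNReal.inv_le_inv.2 hp)
    simpa using h1
  have hθ0 : 0 ≤ (p⁻¹).toReal := ENNReal.toReal_nonneg
  obtain ⟨v, hv, hfv⟩ := hf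
  set r : ℝ := (2 : ℝ) ^ j with hr
  have hr0 : 0 < r := by positivity
  set κ : Vec d → ℝ≥0∞ := fun z => ‖r ^ d * lpKernel φ (r • z)‖ₑ with hκ
  have hκi : ∫⁻ z, κ z ≤ H := (lintegral_enorm_dilation hφ.measurable hr0).trans_le hH1
  have hκs : ∀ z, κ z ≤ ENNReal.ofReal (r ^ d) * H := by
    intro z
    rw [hκ]
    dsimp only
    rw [enorm_mul, Real.enorm_of_nonneg (by positivity)]
    gcongr
    exact hH _
  have hκm : Measurable (Function.uncurry fun y x : Vec d => κ (x - y)) :=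
    (by fun_prop : Continuous fun q : Vec d × Vec d =>
      ‖r ^ d * lpKernel φ (r • (q.2 - q.1))‖ₑ).measurable
  have hmain := eLpNorm_kernel_le (μ := volume) hκm (v := fun y => ‖v y‖ₑ) hv.enorm
    (K := H) (L := ENNReal.ofReal (r ^ d) * H)
    (fun y => by rwa [lintegral_sub_left_eq_self κ y])
    (fun x => by rwa [lintegral_sub_right_eq_self κ x]) (fun _ _ => hκs _) hp
  have hpt : ∀ x, ‖dyadicBlock φ j f x‖ₑ ≤ ∫⁻ y, κ (x - y) * ‖v y‖ₑ := by
    intro x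
    refine (enorm_integral_le_lintegral_enorm _).trans (le_of_eq (lintegral_congr_ae ?_))
    filter_upwards [hfv] with y hy
    rw [enorm_smul, hy]
  have hf2 : eLpNorm f 2 volume = (∫⁻ y, ‖v y‖ₑ ^ (2 : ℝ)) ^ (1 / 2 : ℝ) := by
    rw [eLpNorm_congr_ae hfv, eLpNorm_eq_lintegral_rpow_enorm_toReal (by simp) (by simp)]
    simp
  rw [hf2]
  refine (eLpNorm_mono_enorm (g := fun x => ∫⁻ y, κ (x - y) * ‖v y‖ₑ)
    fun x => by simpa using hpt x).trans (hmain.trans (le_of_eq ?_))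
  congr 1
  -- The exponents of `K` and `L` add up to 1, leaving a single `H`; the power `1/2 - 1/p` of `r^d`
  -- is the frequency factor.
  rw [ENNReal.mul_rpow_of_nonneg _ _ (by linarith), mul_left_comm,
    ← ENNReal.rpow_add_of_nonneg _ _ (by linarith) (by linarith), mul_comm,
    ENNReal.ofReal_rpow_of_nonneg (by positivity) (by linarith)]
  congr 2
  · rw [show (1 / 2 + (p⁻¹).toReal + (1 / 2 - (p⁻¹).toReal) : ℝ) = 1 by ring, ENNReal.rpow_one]
  · rw [hr, ← Real.rpow_intCast, ← Real.rpow_natCast, ← Real.rpow_mul (by positivity),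
      ← Real.rpow_mul (by positivity)]
    congr 1
    ring

end Dyadic

/-! ### Summation of the low frequencies and conclusion -/

/-- The geometric series of the weights of the dyadic blocks below frequency `2 ^ J`. -/
theorem tsum_ofReal_two_rpow_le {σ : ℝ} (hσ : 1 / 2 ≤ σ) (J : ℝ) :
    ∑' j : {j : ℤ // (j : ℝ) < J}, ENNReal.ofReal ((2 : ℝ) ^ (σ * (j : ℤ))) ≤
      4 * ENNReal.ofReal ((2 : ℝ) ^ (σ * J)) := by
  -- The largest integer strictly below `J`; the blocks are counted downwards from it.
  set j₀ : ℤ := ⌈J⌉ - 1 with hj₀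
  have hle : ∀ j : {j : ℤ // (j : ℝ) < J}, (j : ℤ) ≤ j₀ := fun j =>
    Int.le_sub_one_of_lt (Int.lt_ceil.2 j.2)
  have hj₀J : (j₀ : ℝ) ≤ J := (Int.lt_ceil.1 (by omega : j₀ < ⌈J⌉)).le
  set i : {j : ℤ // (j : ℝ) < J} → ℕ := fun j => (j₀ - j).toNat with hi
  have hinj : Function.Injective i := by
    intro a b hab
    have ha := hle a
    have hb := hle b
    simp only [hi] at hab
    exact Subtype.ext (by omega)
  set q : ℝ≥0∞ := ENNReal.ofReal ((2 : ℝ) ^ (-σ)) with hq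
  have hterm : ∀ j : {j : ℤ // (j : ℝ) < J}, ENNReal.ofReal ((2 : ℝ) ^ (σ * (j : ℤ))) =
      ENNReal.ofReal ((2 : ℝ) ^ (σ * j₀)) * q ^ i j := by
    intro j
    have hcast : ((i j : ℕ) : ℝ) = (j₀ : ℝ) - (j : ℤ) := by
      have h : ((i j : ℕ) : ℤ) = j₀ - j := Int.toNat_of_nonneg (by have := hle j; omega)
      exact_mod_cast h
    rw [hq, ← ENNReal.ofReal_pow (by positivity), ← ENNReal.ofReal_mul (by positivity),
      ← Real.rpow_natCast, ← Real.rpow_mul (by norm_num), ← Real.rpow_add (by norm_num), hcast]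
    congr 2
    ring
  -- The ratio is at most `2^{-1/2} ≤ 3/4`, so the geometric series is at most 4 for every `σ ≥
  -- 1/2`.
  have hq34 : q ≤ ENNReal.ofReal (3 / 4) := by
    refine ENNReal.ofReal_le_ofReal ?_
    have h1 : (2 : ℝ) ^ (-σ) ≤ 2 ^ (-(1 / 2) : ℝ) :=
      Real.rpow_le_rpow_of_exponent_le (by norm_num) (by linarith)
    refine h1.trans ?_
    rw [Real.rpow_neg (by norm_num), ← Real.sqrt_eq_rpow]
    refine inv_le_of_inv_le₀ (by norm_num) ?_
    refine Real.le_sqrt_of_sq_le ?_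
    norm_num
  have hgeom : (1 - q)⁻¹ ≤ 4 := by
    rw [ENNReal.inv_le_iff_inv_le]
    calc (4 : ℝ≥0∞)⁻¹ = 1 - ENNReal.ofReal (3 / 4) := by
          rw [← ENNReal.ofReal_one, ← ENNReal.ofReal_sub _ (by norm_num), ← ENNReal.ofReal_ofNat,
            ← ENNReal.ofReal_inv_of_pos (by norm_num)]
          norm_num
      _ ≤ 1 - q := tsub_le_tsub_left hq34 1
  simp_rw [hterm]
  rw [ENNReal.tsum_mul_left]
  calc _ ≤ ENNReal.ofReal ((2 : ℝ) ^ (σ * J)) * ∑' n : ℕ, q ^ n := by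
        gcongr
        · norm_num
        · exact ENNReal.tsum_comp_le_tsum_of_injective hinj fun n => q ^ n
    _ ≤ ENNReal.ofReal ((2 : ℝ) ^ (σ * J)) * 4 := by
        rw [ENNReal.tsum_geometric]
        gcongr
    _ = _ := mul_comm _ _

/-- By completeness the series converges absolutely in `L^p`, and its sum there agrees almost
everywhere with the pointwise sum, so the triangle inequality passes to the limit. -/
theorem eLpNorm_tsum_le {α E ι : Type*} [MeasurableSpace α] {μ : Measure α} [NormedAddCommGroup E]
    [CompleteSpace E] [Countable ι] {p : ℝ≥0∞} (hp : 1 ≤ p) {f : ι → α → E}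
    (hf : ∀ i, AEStronglyMeasurable (f i) μ) (hsum : ∑' i, eLpNorm (f i) p μ ≠ ⊤) :
    eLpNorm (fun x => ∑' i, f i x) p μ ≤ ∑' i, eLpNorm (f i) p μ := by
  have : Fact (1 ≤ p) := ⟨hp⟩
  have hmem : ∀ i, MemLp (f i) p μ := fun i =>
    ⟨hf i, (ENNReal.le_tsum i).trans_lt hsum.lt_top⟩
  set F : ι → Lp E p μ := fun i => (hmem i).toLp (f i) with hF
  have hFn : ∀ i, ‖F i‖ₑ = eLpNorm (f i) p μ := fun i => by
    rw [Lp.enorm_def, eLpNorm_congr_ae (hmem i).coeFn_toLp]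
  have hFs : ∑' i, ‖F i‖ₑ ≠ ⊤ := by simpa only [hFn] using hsum
  have hae : ∀ᵐ x ∂μ, ∀ i, F i x = f i x := ae_all_iff.2 fun i => (hmem i).coeFn_toLp
  have heq : (fun x => ∑' i, f i x) =ᵐ[μ] ⇑(∑' i, F i) := by
    filter_upwards [Lp.coeFn_tsum hFs, hae] with x hx h
    rw [hx]
    simp only [h]
  rw [eLpNorm_congr_ae heq, ← Lp.enorm_def]
  simpa only [hFn] using enorm_tsum_le_tsum_enorm (f := F)

/-- A field in `L^2 ∩ L^p` is sparse below the frequency scale set by `ellZero`. -/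
theorem isFreqSparse_of_ellZero_le {d : ℕ} (hd : 3 ≤ d) {φ : Vec d → ℝ} {H : ℝ≥0}
    (hH0 : 1 ≤ H) (hφ : Continuous (lpKernel φ)) (hH : ∀ x, ‖lpKernel φ x‖ₑ ≤ H)
    (hH1 : ∫⁻ x, ‖lpKernel φ x‖ₑ ≤ H) {p : ℝ≥0∞} (hp : (d : ℝ≥0∞) < p) {f : Vec d → Vec d}
    (hf2 : MemLp f 2 volume) (hfp : MemLp f p volume) {β : ℝ} (hβ : 0 < β) {J : ℝ}
    (hJ : (4 * (H : ℝ)) ^ 2 * (ellZero p f * β ^ (-muExp d p)) ≤ (2 : ℝ) ^ (-J)) :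
    IsFreqSparse φ p β J f := by
  have hp2 : (2 : ℝ≥0∞) ≤ p := le_trans (by exact_mod_cast (by omega : 2 ≤ d)) hp.le
  have hp1 : (1 : ℝ≥0∞) ≤ p := le_trans (by norm_num) hp2
  set σ : ℝ := (d : ℝ) * (1 / 2 - (p⁻¹).toReal) with hσdef
  -- `σ = d/2 - d/p` with `d/p ≤ 1` and `d ≥ 3`; this uniform lower bound is what keeps the constant
  -- independent of `p`.
  have hσ : 1 / 2 ≤ σ := by
    have h := toReal_inv_lt (by omega) hp
    have hd' : (3 : ℝ) ≤ d := by exact_mod_cast hd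
    have h2 : (d : ℝ) * (p⁻¹).toReal ≤ d * (d : ℝ)⁻¹ := by gcongr
    rw [mul_inv_cancel₀ (by positivity)] at h2
    rw [hσdef, mul_sub]
    linarith
  have hσ0 : 0 < σ := by linarith
  set N := (eLpNorm f 2 volume).toReal with hN
  set P := (eLpNorm f p volume).toReal with hP
  have hNe : eLpNorm f 2 volume = ENNReal.ofReal N := (ENNReal.ofReal_toReal hf2.2.ne).symm
  have hPe : eLpNorm f p volume = ENNReal.ofReal P := (ENNReal.ofReal_toReal hfp.2.ne).symm
  have hN0 : 0 ≤ N := ENNReal.toReal_nonneg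
  have hP0 : 0 ≤ P := ENNReal.toReal_nonneg
  have hH0' : (1 : ℝ) ≤ H := by exact_mod_cast hH0
  have hreal : H * (4 * (2 : ℝ) ^ (σ * J)) * N ≤ β * P := by
    -- If `‖f‖_p = 0` then `f` vanishes almost everywhere and both sides are 0; otherwise division
    -- by `P` is legitimate.
    rcases hP0.eq_or_lt with hPz | hPpos
    · have hfz : f =ᵐ[volume] 0 := by
        rw [← eLpNorm_eq_zero_iff hfp.1 (zero_lt_one.trans_le hp1).ne', hPe, ← hPz]
        simp
      have hNz : N = 0 := by
        rw [hN, eLpNorm_congr_ae hfz]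
        simp
      rw [hNz, ← hPz]
      simp
    · have h1 := Real.rpow_le_rpow (by unfold ellZero; positivity) hJ hσ0.le
      have hμ : muExp d p * σ = 1 := by
        rw [muExp, ← hσdef, inv_mul_cancel₀ hσ0.ne']
      rw [Real.mul_rpow (by positivity) (by unfold ellZero; positivity),
        Real.mul_rpow (by unfold ellZero; positivity) (by positivity), ellZero,
        ← Real.rpow_mul (by positivity), ← Real.rpow_mul hβ.le, hμ, neg_mul, hμ, Real.rpow_one,
        Real.rpow_neg_one, ← Real.rpow_mul (by norm_num), ← hN, ← hP] at h1
      -- The square in the constant `(4H)^2` is chosen for this: `(4H)^{2σ} ≥ 4H`, because `4H ≥ 1`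
      -- and `2σ ≥ 1`.
      have h2 : 4 * (H : ℝ) ≤ ((4 * (H : ℝ)) ^ 2) ^ σ := by
        calc 4 * (H : ℝ) = ((4 * (H : ℝ)) ^ 2) ^ (1 / 2 : ℝ) := by
              rw [← Real.rpow_natCast, ← Real.rpow_mul (by positivity)]
              norm_num
          _ ≤ _ := Real.rpow_le_rpow_of_exponent_le (by nlinarith) hσ
      have h3 : 4 * (H : ℝ) * (N / P * β⁻¹) ≤ 2 ^ (-J * σ) :=
        (mul_le_mul_of_nonneg_right h2 (by positivity)).trans h1
      have h4 : (2 : ℝ) ^ (-J * σ) = (2 ^ (σ * J))⁻¹ := by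
        rw [← Real.rpow_neg (by norm_num)]
        congr 1
        ring
      rw [h4] at h3
      have h5 : 0 < (2 : ℝ) ^ (σ * J) := by positivity
      calc H * (4 * (2 : ℝ) ^ (σ * J)) * N
          = (4 * (H : ℝ) * (N / P * β⁻¹)) * (2 ^ (σ * J) * (β * P)) := by
            field_simp
        _ ≤ (2 ^ (σ * J))⁻¹ * (2 ^ (σ * J) * (β * P)) := by gcongr
        _ = β * P := by field_simp
  have hsum : ∑' j : {j : ℤ // (j : ℝ) < J}, eLpNorm (dyadicBlock φ j f) p volume ≤
      ENNReal.ofReal β * eLpNorm f p volume := by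
    calc _ ≤ ∑' j : {j : ℤ // (j : ℝ) < J},
          H * ENNReal.ofReal ((2 : ℝ) ^ (σ * (j : ℤ))) * eLpNorm f 2 volume :=
          ENNReal.tsum_le_tsum fun j => eLpNorm_dyadicBlock_le hφ hH hH1 hf2.1 hp2 j
      _ ≤ H * (4 * ENNReal.ofReal ((2 : ℝ) ^ (σ * J))) * eLpNorm f 2 volume := by
          rw [ENNReal.tsum_mul_right, ENNReal.tsum_mul_left]
          gcongr
          exact tsum_ofReal_two_rpow_le hσ J
      _ = ENNReal.ofReal (H * (4 * (2 : ℝ) ^ (σ * J)) * N) := by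
          rw [hNe, ENNReal.ofReal_mul (by positivity), ENNReal.ofReal_mul (by positivity),
            ENNReal.ofReal_mul (by positivity)]
          simp
      _ ≤ ENNReal.ofReal (β * P) := ENNReal.ofReal_le_ofReal hreal
      _ = _ := by rw [hPe, ENNReal.ofReal_mul hβ.le]
  have hmeas : ∀ j : {j : ℤ // (j : ℝ) < J},
      AEStronglyMeasurable (dyadicBlock φ j f) volume := fun j =>
    aestronglyMeasurable_dyadicBlock hφ hf2.1 j
  have hne : ∑' j : {j : ℤ // (j : ℝ) < J}, eLpNorm (dyadicBlock φ j f) p volume ≠ ⊤ :=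
    (hsum.trans_lt (ENNReal.mul_lt_top ENNReal.ofReal_lt_top hfp.2)).ne
  refine ⟨hfp, ?_, (eLpNorm_tsum_le hp1 hmeas hne).trans hsum⟩
  filter_upwards [summable_norm_of_tsum_eLpNorm_ne_top hp1 hmeas hne] with x hx
  exact hx.of_norm

theorem mainTheorem8 (d : ℕ) (hd : 3 ≤ d) (φ : Vec d → ℝ) (hφ : IsLittlewoodPaley φ) :
    ∃ C : ℝ, 0 < C ∧
      ∀ p : ℝ≥0∞, (d : ℝ≥0∞) < p →
      ∀ (T : ℝ≥0∞) (u₀ : Vec d → Vec d) (u : ℝ → Vec d → Vec d),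
        MemLpSigma u₀ 2 → MemLpSigma u₀ p → IsStrongSolution p T u₀ u →
        ∀ t : ℝ, 0 < t → ENNReal.ofReal t < T →
          MemLp (u t) 2 volume ∧
          ∀ β : ℝ, 0 < β → β < 1 →
          ∀ J : ℝ, C * (ellZero p (u t) * β ^ (-muExp d p)) ≤ (2 : ℝ) ^ (-J) →
            IsFreqSparse φ p β J (u t) := by
  obtain ⟨hcont, H, hH0, hH, hH1⟩ := hφ.lpKernel_bounds
  have hH0' : (1 : ℝ) ≤ H := by exact_mod_cast hH0
  refine ⟨(4 * (H : ℝ)) ^ 2, by positivity, fun p hp T u₀ u hu₀ _ hu t ht htT => ?_⟩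
  have h2 := hu.memLp_two (by omega) hp hu₀.1 ht htT
  exact ⟨h2, fun β hβ _ J hJ =>
    isFreqSparse_of_ellZero_le hd hH0 hcont hH hH1 hp h2 (hu.memLp t ht htT) hβ hJ⟩
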